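/- Words are over the alphabet $\{0,1,2\}$. A factor of an infinite word $w=w_0w_1w_2\cdots$ is a finite block of consecutive letters of $w$, and $w$ is recurrent if each of its factors occurs infinitely many times in $w$; the recurrent factors of $w$ are the finite words that occur infinitely many times in $w$. A formula is a finite list of words (its fragments, separated by dots) over the variables $A,B,C$. An infinite word $w$ avoids a formula $f$ if there is no non-erasing morphism $h:\{A,B,C\}^*\to\{0,1,2\}^*$ (that is, with $h(A),h(B),h(C)$ all non-empty) such that $h(p)$ is a factor of $w$ for every fragment $p$ of $f$. Let $b_3$ be the infinite fixed point of the morphism $0\mapsto 012$, $1\mapsto 02$, $2\mapsto 1$. For $c\in\{0,1,2\}$ let $\sigma_c$ be the letter permutation that fixes $c$ and exchanges the other two letters, applied letterwise to infinite words. **Theorem.** Let $f$ be one of the formulas $$f_b=ABCAB.ABCBA.ACB.BAC,\quad f_1=ABCA.BCAB.BCB.CBA,\quad f_2=ABCAB.BCB.AC,$$ $$f_3=ABCA.BCAB.ACB.BCB,\quad f_4=ABCA.BCAB.BCB.AC.BA.$$ 1. Every recurrent infinite ternary word avoiding $f$ has the same set of factors as $b_3$, $\sigma_0(b_3)$ or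 $\sigma_2(b_3)$. 2. The words $b_3$, $\sigma_0(b_3)$ and $\sigma_2(b_3)$ are recurrent and avoid $f$. 3. Every infinite ternary word avoiding $f$ (recurrent or not) has the same set of recurrent factors as $b_3$, $\sigma_0(b_3)$ or $\sigma_2(b_3)$. Thus, up to renaming letters, $b_3$ is essentially the only infinite ternary word avoiding $f$. -/

import Mathlib

/-! Infinite words, avoidance of formulas, and the ternary Thue word `b₃`. -/

/-- An infinite word over the alphabet `α`. -/
abbrev InfWord (α : Type*) := ℕ → α

/-- The factor of length `n` of `w` that starts at position `i`. -/
def InfWord.factorAt {α : Type*} (w : InfWord α) (i n : ℕ) : List α :=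
  List.ofFn (fun k : Fin n => w (i + k))

/-- The finite word `u` appears in `w` at position `i`. -/
def InfWord.OccursAt {α : Type*} (w : InfWord α) (u : List α) (i : ℕ) : Prop :=
  w.factorAt i u.length = u

/-- The set of (finite) factors of `w`. -/
def InfWord.factors {α : Type*} (w : InfWord α) : Set (List α) :=
  {u | ∃ i, w.OccursAt u i}

/-- The set of recurrent factors of `w`: the finite words that appear infinitely many times. -/
def InfWord.recurrentFactors {α : Type*} (w : InfWord α) : Set (List α) :=
  {u | {i | w.OccursAt u i}.Infinite}

/-- A word is recurrent if each of its finite factors appears infinitely many times. -/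
def InfWord.Recurrent {α : Type*} (w : InfWord α) : Prop :=
  ∀ u ∈ w.factors, u ∈ w.recurrentFactors

/-- Two infinite words are equivalent if they have the same set of factors. -/
def InfWord.Equivalent {α : Type*} (v w : InfWord α) : Prop :=
  v.factors = w.factors

/-- The image of the finite word `u` under the morphism of free monoids that sends each letter `a`
to `h a`. -/
def morphImage {α β : Type*} (h : α → List β) (u : List α) : List β :=
  u.flatMap h

/-- A formula over the variables `Δ`, given as the list of its fragments. -/
abbrev Formula (Δ : Type*) := List (List Δ)

/-- The morphism `h` is an occurrence of the formula `f` in `w`: it is non-erasing, and the image of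
every fragment is a factor of `w`. -/
def IsOccurrence {Δ α : Type*} (h : Δ → List α) (f : Formula Δ) (w : InfWord α) : Prop :=
  (∀ X, h X ≠ []) ∧ ∀ p ∈ f, morphImage h p ∈ w.factors

/-- The infinite word `w` avoids the formula `f`. -/
def InfWord.Avoids {Δ α : Type*} (w : InfWord α) (f : Formula Δ) : Prop :=
  ¬ ∃ h : Δ → List α, IsOccurrence h f w

/-- The three variables of ternary formulas. -/
inductive TVar where
  | A
  | B
  | C

/-- `ABCAB.ABCBA.ACB.BAC` -/
def formulaB : Formula TVar :=
  [[.A, .B, .C, .A, .B], [.A, .B, .C, .B, .A], [.A, .C, .B], [.B, .A, .C]]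

/-- `ABCA.BCAB.BCB.CBA` -/
def formula1 : Formula TVar :=
  [[.A, .B, .C, .A], [.B, .C, .A, .B], [.B, .C, .B], [.C, .B, .A]]

/-- `ABCAB.BCB.AC` -/
def formula2 : Formula TVar :=
  [[.A, .B, .C, .A, .B], [.B, .C, .B], [.A, .C]]

/-- `ABCA.BCAB.ACB.BCB` -/
def formula3 : Formula TVar :=
  [[.A, .B, .C, .A], [.B, .C, .A, .B], [.A, .C, .B], [.B, .C, .B]]

/-- `ABCA.BCAB.BCB.AC.BA` -/
def formula4 : Formula TVar :=
  [[.A, .B, .C, .A], [.B, .C, .A, .B], [.B, .C, .B], [.A, .C], [.B, .A]]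

/-- The morphism `0 ↦ 012`, `1 ↦ 02`, `2 ↦ 1`. -/
def thueMorphism : Fin 3 → List (Fin 3) :=
  ![[0, 1, 2], [0, 2], [1]]

/-- The infinite word `w` is a fixed point of the morphism `h`: for every prefix `u` of `w`, the
image of `u` is again a prefix of `w`. For a non-erasing `h` these images exhaust the image of
`w`. -/
def InfWord.IsFixedPoint {α : Type*} (w : InfWord α) (h : α → List α) : Prop :=
  ∀ n, w.OccursAt (morphImage h (w.factorAt 0 n)) 0

/-- The word `b₃`: its letter at position `n` is read off the `n`-th iterate of the morphism at the
letter `0`, which has length greater than `n`. It is shown below to be the only fixed point of the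
morphism. -/
def b3 : InfWord (Fin 3) :=
  fun n => ((morphImage thueMorphism)^[n] [0]).getD n 0

/-- The permutation of the three letters that fixes `c` and exchanges the two others. -/
def sigma (c : Fin 3) : Equiv.Perm (Fin 3) :=
  Equiv.swap (c + 1) (c + 2)

/-- The image of an infinite word under a letter-to-letter morphism. -/
def InfWord.map {α β : Type*} (g : α → β) (w : InfWord α) : InfWord β :=
  fun n => g (w n)

theorem thueMorphism_iterate_prefix (n : ℕ) :
    (morphImage thueMorphism)^[n] [0] <+: (morphImage thueMorphism)^[n + 1] [0] := by
  induction n with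
  | zero => exact ⟨[1, 2], rfl⟩
  | succ n ih =>
    obtain ⟨t, ht⟩ := ih
    refine ⟨morphImage thueMorphism t, ?_⟩
    have h1 := congrArg (morphImage thueMorphism) ht
    rw [Function.iterate_succ_apply' _ (n + 1), ← h1, Function.iterate_succ_apply' _ n]
    simp [morphImage]

theorem thueMorphism_iterate_prefix_of_le {m n : ℕ} (h : m ≤ n) :
    (morphImage thueMorphism)^[m] [0] <+: (morphImage thueMorphism)^[n] [0] := by
  induction n, h using Nat.le_induction with
  | base => exact List.prefix_rfl
  | succ n _ ih => exact ih.trans (thueMorphism_iterate_prefix n)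

theorem morphImage_length_le {α β : Type*} (h : α → List β) (hh : ∀ a, h a ≠ []) (u : List α) :
    u.length ≤ (morphImage h u).length := by
  induction u with
  | nil => simp
  | cons a u ih =>
    have := List.length_pos_of_ne_nil (hh a)
    simp only [morphImage, List.flatMap_cons, List.length_append, List.length_cons] at *
    omega

theorem thueMorphism_ne_nil (a : Fin 3) : thueMorphism a ≠ [] := by
  fin_cases a <;> simp [thueMorphism]

theorem thueMorphism_iterate_length (n : ℕ) :
    n < ((morphImage thueMorphism)^[n] [0]).length := by
  suffices h : ∀ n, ∃ t, (morphImage thueMorphism)^[n] [0] = 0 :: t ∧ n ≤ t.length by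
    obtain ⟨t, ht, hn⟩ := h n
    rw [ht, List.length_cons]; omega
  intro n
  induction n with
  | zero => exact ⟨[], rfl, le_rfl⟩
  | succ n ih =>
    obtain ⟨t, ht, hn⟩ := ih
    refine ⟨[1, 2] ++ morphImage thueMorphism t, ?_, ?_⟩
    · rw [Function.iterate_succ_apply', ht]; rfl
    · have := morphImage_length_le _ thueMorphism_ne_nil t
      simp only [List.length_append, List.length_cons, List.length_nil]; omega

theorem InfWord.occursAt_iff {α : Type*} (w : InfWord α) (u : List α) (i : ℕ) :
    w.OccursAt u i ↔ ∀ k (hk : k < u.length), w (i + k) = u[k] := by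
  unfold InfWord.OccursAt InfWord.factorAt
  constructor
  · intro h k hk
    have := List.getElem_of_eq h (i := k) (by simpa using hk)
    simpa using this
  · intro h
    apply List.ext_getElem
    · simp
    · intro k h1 h2
      simpa using h k h2

theorem b3_occursAt_iterate (m : ℕ) : b3.OccursAt ((morphImage thueMorphism)^[m] [0]) 0 := by
  rw [InfWord.occursAt_iff]
  intro k hk
  have hk' := thueMorphism_iterate_length k
  rw [Nat.zero_add, b3, List.getD_eq_getElem _ _ hk']
  rcases le_total k m with h | h
  · exact (thueMorphism_iterate_prefix_of_le h).getElem hk'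
  · exact ((thueMorphism_iterate_prefix_of_le h).getElem hk).symm

/-- `b₃` is a fixed point of the morphism, and it is the only one. -/
theorem isFixedPoint_thueMorphism_iff (w : InfWord (Fin 3)) :
    w.IsFixedPoint thueMorphism ↔ w = b3 := by
  have pre : ∀ (v : InfWord (Fin 3)) (p q : List (Fin 3)), p <+: q → v.OccursAt q 0 →
      v.OccursAt p 0 := by
    intro v p q hpq hq
    rw [InfWord.occursAt_iff] at hq ⊢
    intro k hk
    rw [hq k (hk.trans_le hpq.length_le), hpq.getElem hk]
  constructor
  · intro h
    have h0 : w 0 = 0 := by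
      have h1 := h 1
      have hf : w.factorAt 0 1 = [w 0] := by simp [InfWord.factorAt]
      rw [InfWord.occursAt_iff, hf] at h1
      generalize hx : w 0 = x at h1
      fin_cases x
      · rfl
      · have := h1 0 (by decide)
        simp [hx, morphImage, thueMorphism] at this
      · have := h1 0 (by decide)
        simp [hx, morphImage, thueMorphism] at this
    have it : ∀ n, w.OccursAt ((morphImage thueMorphism)^[n] [0]) 0 := by
      intro n
      induction n with
      | zero => simp [InfWord.occursAt_iff, h0]
      | succ n ih =>
        rw [Function.iterate_succ_apply']
        have := h ((morphImage thueMorphism)^[n] [0]).length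
        rwa [show w.factorAt 0 _ = _ from ih] at this
    funext n
    have h1 := (w.occursAt_iff _ _).1 (it n) n (thueMorphism_iterate_length n)
    have h2 := (b3.occursAt_iff _ _).1 (b3_occursAt_iterate n) n (thueMorphism_iterate_length n)
    simpa using h1.trans h2.symm
  · rintro rfl n
    refine pre _ _ _ ?_ (b3_occursAt_iterate (n + 1))
    rw [Function.iterate_succ_apply']
    have hp : b3.factorAt 0 n <+: (morphImage thueMorphism)^[n] [0] := by
      have h := b3_occursAt_iterate n
      rw [InfWord.occursAt_iff] at h
      have hl := thueMorphism_iterate_length n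
      rw [List.prefix_iff_eq_take]
      apply List.ext_getElem
      · simp [InfWord.factorAt]; omega
      · intro k h1 h2
        have hk : k < n := by simpa [InfWord.factorAt] using h1
        have := h k (by omega)
        simpa [InfWord.factorAt] using this
    obtain ⟨t, ht⟩ := hp
    exact ⟨morphImage thueMorphism t, by rw [← ht]; simp [morphImage]⟩

/-! Every fragment of each `f` is a factor of a fragment of `formulaB`, so a word avoiding `f`
avoids `formulaB`, and uniqueness has to be shown for `formulaB` only. In the other direction,
`formulaB` is avoided by `b3` because `formula2` is.

Uniqueness. Let `R` be the set of recurrent factors of a word avoiding `formulaB`. It is closed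
under factors and extendable on both sides, and it contains no square: two separated occurrences of
`uu` would allow `A = B = u`. Finite backtracking shows that `R` misses both words of one of the
pairs {010, 212}, {020, 121}, {101, 202} (`exists_avoided_pair`). Indeed, if it met all three pairs
it would contain all six words `bcb`. One-letter values of the variables then exclude all words
`abcab`, and the values `A = xy`, `B = z`, `C = xzy` lead to a contradiction.

After a permutation of letters, 010 and 212 are missing. Then 0 and 2 eventually alternate once the
letters 1 are deleted, so the word is eventually the difference word of a binary word `s` (0 is an
ascent, 2 a descent, 1 an equality). Squares of the difference word correspond to overlaps of `s`,
so each period of overlaps dies out in `s`. Such an `s` has a suffix that can be desubstituted under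
the Thue–Morse morphism, and the preimage has the same property. Iterating, `s` looks like the
Thue–Morse word at every scale, and the recurrent factors of its difference word are the factors of
`b3`, the difference word of Thue–Morse.

Avoidance. An occurrence of a formula in `b3` is lifted to the Thue–Morse word, where infinite
descent applies. A variable with a long value has occurrences of one parity only, hence a shorter
preimage; a variable with a short value is replaced by that value. `check` follows these moves, and
a branch closes at a contradiction, a square, or a repetition of an earlier state, which a minimal
occurrence excludes (`not_realizes_of_check`). -/

/-! ### Square-free languages and backtracking search -/

/-- A nonempty set of words closed under factors, in which every word extends on both sides, and
which contains no square. -/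
structure SquareFreeLanguage {α : Type*} (R : Set (List α)) : Prop where
  nil_mem : [] ∈ R
  of_infix : ∀ {u v : List α}, u <:+: v → v ∈ R → u ∈ R
  exists_concat : ∀ {u}, u ∈ R → ∃ c, u ++ [c] ∈ R
  exists_cons : ∀ {u}, u ∈ R → ∃ c, c :: u ∈ R
  eq_nil_of_square : ∀ {u}, u ++ u ∈ R → u = []

/-- The prefixes of length `n` of the two words exist and are equal. -/
def eqPrefix {α : Type*} [BEq α] : ℕ → List α → List α → Bool
  | 0, _, _ => true
  | n + 1, a :: u, b :: v => a == b && eqPrefix n u v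
  | _, _, _ => false

/-- Some suffix of `t` begins with a prefix of `w`, of length `l` for `t` itself, and longer by the
number of letters of `t` that were dropped. -/
def hasSquareFrom {α : Type*} [BEq α] (w : List α) : ℕ → List α → Bool
  | _, [] => false
  | l, b :: t => eqPrefix l w (b :: t) || hasSquareFrom w (l + 1) t

/-- The word `w` has a nonempty square as a prefix. -/
def hasSquarePrefix {α : Type*} [BEq α] (w : List α) : Bool :=
  hasSquareFrom w 1 w.tail

/-- Backtracking search, extending alternately to both sides, for square-free extensions of `w`
with no factor in `B` (where `B'` is the list of reversals of `B`). The value `true` means that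
there are only finitely many. -/
def dead : ℕ → List (List (Fin 3)) → List (List (Fin 3)) → List (Fin 3) → Bool
  | 0, _, _, _ => false
  | n + 1, B, B', w => [0, 1, 2].all fun c =>
      hasSquarePrefix (c :: w) || B.any (fun b => eqPrefix b.length b (c :: w)) ||
        dead n B' B (c :: w).reverse

theorem SquareFreeLanguage.reverse {α : Type*} {R : Set (List α)} (hR : SquareFreeLanguage R) :
    SquareFreeLanguage {u | u.reverse ∈ R} where
  nil_mem := hR.nil_mem
  of_infix h hv := hR.of_infix (List.reverse_infix.2 h) hv
  exists_concat {u} h := by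
    obtain ⟨c, hc⟩ := hR.exists_cons h
    exact ⟨c, by simpa using hc⟩
  exists_cons {u} h := by
    obtain ⟨c, hc⟩ := hR.exists_concat h
    exact ⟨c, by simpa using hc⟩
  eq_nil_of_square {u} h := by
    have := hR.eq_nil_of_square (u := u.reverse) (by simpa using h)
    simpa using this

theorem take_eq_of_eqPrefix {α : Type*} [BEq α] [LawfulBEq α] :
    ∀ {n : ℕ} {u v : List α}, eqPrefix n u v = true →
    u.take n = v.take n ∧ n ≤ u.length
  | 0, _, _, _ => by simp
  | n + 1, a :: u, b :: v, h => by
    rw [eqPrefix, Bool.and_eq_true] at h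
    have h1 : a = b := eq_of_beq h.1
    have h2 := take_eq_of_eqPrefix h.2
    exact ⟨by rw [List.take_succ_cons, List.take_succ_cons, h1, h2.1], by simpa using h2.2⟩
  | _ + 1, [], _, h => by simp [eqPrefix] at h
  | _ + 1, _ :: _, [], h => by simp [eqPrefix] at h

theorem isPrefix_of_eqPrefix {α : Type*} [BEq α] [LawfulBEq α] {u v : List α}
    (h : eqPrefix u.length u v = true) : u <+: v := by
  have h1 := (take_eq_of_eqPrefix h).1
  rw [List.take_length] at h1
  exact h1 ▸ List.take_prefix _ _

theorem exists_square_of_hasSquareFrom {α : Type*} [BEq α] [LawfulBEq α] {w : List α} {l : ℕ}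
    {t : List α}
    (hl : 0 < l) (ht : t = w.drop l) (h : hasSquareFrom w l t = true) :
    ∃ u, u ≠ [] ∧ u ++ u <+: w := by
  induction t generalizing l with
  | nil => simp [hasSquareFrom] at h
  | cons b t ih =>
    rw [hasSquareFrom, Bool.or_eq_true] at h
    rcases h with h | h
    · obtain ⟨h1, h2⟩ := take_eq_of_eqPrefix h
      refine ⟨w.take l, fun h0 => ?_, w.drop (l + l), ?_⟩
      · have h3 := congrArg List.length h0
        rw [List.length_take, List.length_nil] at h3
        omega
      · conv_lhs => enter [1, 2]; rw [h1, ht]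
        rw [← List.drop_drop, List.append_assoc, List.take_append_drop, List.take_append_drop]
    · refine ih (Nat.succ_pos l) ?_ h
      rw [Nat.succ_eq_add_one, ← List.drop_drop, ← ht, List.drop_one, List.tail_cons]

theorem exists_square_of_hasSquarePrefix {α : Type*} [BEq α] [LawfulBEq α] {w : List α}
    (h : hasSquarePrefix w = true) : ∃ u, u ≠ [] ∧ u ++ u <+: w :=
  exists_square_of_hasSquareFrom Nat.one_pos List.drop_one.symm h

theorem SquareFreeLanguage.hasSquarePrefix_eq_false {R : Set (List (Fin 3))}
    (hR : SquareFreeLanguage R) {w : List (Fin 3)} (hw : w ∈ R) : hasSquarePrefix w = false := by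
  by_contra h
  obtain ⟨u, hu, huw⟩ := exists_square_of_hasSquarePrefix (Bool.not_eq_false _ ▸ h)
  exact hu (hR.eq_nil_of_square (hR.of_infix huw.isInfix hw))

/-- A word of `R` has a left extension in `R`, and a new square or forbidden factor must start at
the new letter, so testing prefixes is enough. Passing to the reversed language makes the next
extension a right one; this exchanges `B` and `B'`. -/
theorem SquareFreeLanguage.not_mem_of_dead (n : ℕ) {R : Set (List (Fin 3))}
    (hR : SquareFreeLanguage R) {B B' : List (List (Fin 3))} {w : List (Fin 3)}
    (hB : ∀ b ∈ B, b ∉ R) (hB' : ∀ b ∈ B', b.reverse ∉ R) (h : dead n B B' w = true) :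
    w ∉ R := by
  induction n generalizing R B B' w with
  | zero => simp [dead] at h
  | succ n ih =>
    intro hw
    obtain ⟨c, hc⟩ := hR.exists_cons hw
    rw [dead, List.all_eq_true] at h
    have h3 := h c (by fin_cases c <;> simp)
    rw [hR.hasSquarePrefix_eq_false hc, Bool.false_or, Bool.or_eq_true] at h3
    rcases h3 with h3 | h3
    · obtain ⟨b, hb, hbc⟩ := List.any_eq_true.1 h3
      exact hB b hb (hR.of_infix (isPrefix_of_eqPrefix hbc).isInfix hc)
    · refine ih hR.reverse (w := (c :: w).reverse) hB' ?_ h3 ?_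
      · intro b hb
        rw [Set.mem_ofPred_eq, List.reverse_reverse]
        exact hB b hb
      · simpa using hc

/-- As `dead`, with the reversals of the forbidden factors computed and with fuel `100`. -/
def isDead (B : List (List (Fin 3))) (w : List (Fin 3)) : Bool :=
  dead 100 B (B.map List.reverse) w

theorem SquareFreeLanguage.not_mem_of_isDead {R : Set (List (Fin 3))}
    (hR : SquareFreeLanguage R) {B : List (List (Fin 3))} {w : List (Fin 3)}
    (hB : ∀ b ∈ B, b ∉ R) (h : isDead B w = true) : w ∉ R := by
  refine hR.not_mem_of_dead 100 hB (fun b' hb' => ?_) h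
  obtain ⟨b, hb, rfl⟩ := List.mem_map.1 hb'
  rw [List.reverse_reverse]
  exact hB b hb

/-! ### Test words and the finite computations -/

/-- The third letter. -/
def thirdLetter (b c : Fin 3) : Fin 3 := -(b + c)

/-- The ordered pairs of distinct letters. -/
def letterPairs : List (Fin 3 × Fin 3) := [(0, 1), (0, 2), (1, 0), (1, 2), (2, 0), (2, 1)]

theorem mem_letterPairs {p : Fin 3 × Fin 3} : p ∈ letterPairs ↔ p.1 ≠ p.2 := by
  revert p; decide

/-- The word `bcb`. -/
def wordBCB (p : Fin 3 × Fin 3) : List (Fin 3) := [p.1, p.2, p.1]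

/-- The word `abcab`, where `a` is the third letter. -/
def wordABCAB (p : Fin 3 × Fin 3) : List (Fin 3) :=
  [thirdLetter p.1 p.2, p.1, p.2, thirdLetter p.1 p.2, p.1]

/-- The words `ABCAB`, `ABCBA`, `ACB` and `BAC` for `A = xy`, `B = z`, `C = xzy`. -/
def longABCAB (p : Fin 3 × Fin 3) : List (Fin 3) :=
  let z := thirdLetter p.1 p.2
  [p.1, p.2, z, p.1, z, p.2, p.1, p.2, z]

/-- See `longABCAB`. -/
def longABCBA (p : Fin 3 × Fin 3) : List (Fin 3) :=
  let z := thirdLetter p.1 p.2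
  [p.1, p.2, z, p.1, z, p.2, z, p.1, p.2]

/-- See `longABCAB`. -/
def longACB (p : Fin 3 × Fin 3) : List (Fin 3) :=
  let z := thirdLetter p.1 p.2
  [p.1, p.2, p.1, z, p.2, z]

/-- See `longABCAB`. -/
def longBAC (p : Fin 3 × Fin 3) : List (Fin 3) :=
  let z := thirdLetter p.1 p.2
  [z, p.1, p.2, p.1, z, p.2]

/-- The language given by `ch` contains one word of each of the pairs `{010, 212}`, `{020, 121}`,
`{101, 202}`. -/
def meetsAllPairs (ch : Fin 3 × Fin 3 → Bool) : Bool :=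
  (ch (0, 1) || ch (2, 1)) && (ch (0, 2) || ch (1, 2)) && (ch (1, 0) || ch (2, 0))

/-- For each pair of letters, forbid the first word if `ch` holds there and the second one if it
does not. -/
def bansOfChoice (ch : Fin 3 × Fin 3 → Bool) (f g : Fin 3 × Fin 3 → List (Fin 3)) :
    List (List (Fin 3)) :=
  letterPairs.map fun p => if ch p then f p else g p

/-- The choice function with the given values at the six pairs of distinct letters. -/
def choiceOfBools (b₀ b₁ b₂ b₃ b₄ b₅ : Bool) (p : Fin 3 × Fin 3) : Bool :=
  [b₀, b₁, b₂, b₃, b₄, b₅].getD (letterPairs.idxOf p) false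

theorem choiceOfBools_eq (ch : Fin 3 × Fin 3 → Bool) : ∀ p ∈ letterPairs,
    choiceOfBools (ch (0, 1)) (ch (0, 2)) (ch (1, 0)) (ch (1, 2)) (ch (2, 0)) (ch (2, 1)) p =
      ch p := by
  intro p hp
  simp only [letterPairs, List.mem_cons, List.not_mem_nil, or_false] at hp
  rcases hp with rfl | rfl | rfl | rfl | rfl | rfl <;> rfl

/-- Long binary words contain squares. -/
theorem isDead_letter : ∀ c : Fin 3, isDead [[c]] [] = true := by
  decide +kernel

theorem isDead_permutation : isDead [[0, 1, 2]] [0] = true := by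
  decide +kernel

/-- The bans are those in force when `ch` records which words `bcb` are present: such a word
excludes the corresponding `abcab`. The search starts from a present `bcb`, and failure means that
meeting all three pairs forces all six words. -/
theorem isDead_of_meetsAllPairs : ∀ b₀ b₁ b₂ b₃ b₄ b₅ : Bool,
    let ch := choiceOfBools b₀ b₁ b₂ b₃ b₄ b₅
    meetsAllPairs ch = true → letterPairs.all ch = false →
      isDead (bansOfChoice ch wordABCAB wordBCB)
        (((letterPairs.find? ch).map wordBCB).getD []) = true := by
  decide +kernel

theorem isDead_longACB :
    isDead (longACB (0, 1) :: letterPairs.map wordABCAB) [0, 1, 0] = true := by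
  decide +kernel

theorem isDead_longBAC :
    isDead (longBAC (0, 1) :: letterPairs.map wordABCAB) [0, 1, 0] = true := by
  decide +kernel

/-- The values `A = xy`, `B = z`, `C = xzy` exclude `ABCAB` or `ABCBA` for each pair of letters. The
first Boolean is `true` because the word for the pair `(0, 1)` is assumed present; the other five
are arbitrary. -/
theorem isDead_longABCAB : ∀ b₁ b₂ b₃ b₄ b₅ : Bool,
    isDead (bansOfChoice (choiceOfBools true b₁ b₂ b₃ b₄ b₅) longABCBA longABCAB ++
      letterPairs.map wordABCAB) (longABCAB (0, 1)) = true := by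
  decide +kernel

theorem isDead_forall_longABCAB :
    isDead (letterPairs.map longABCAB ++ letterPairs.map wordABCAB) [0, 1, 0] = true := by
  decide +kernel

/-! ### Languages without occurrences of `formulaB` -/

/-- A square-free language that contains no occurrence of the formula `ABCAB.ABCBA.ACB.BAC`. -/
structure FormulaBFreeLanguage (R : Set (List (Fin 3))) : Prop extends SquareFreeLanguage R where
  avoids : ∀ {a b c : List (Fin 3)}, a ≠ [] → b ≠ [] → c ≠ [] → a ++ b ++ c ++ a ++ b ∈ R →
    a ++ b ++ c ++ b ++ a ∈ R → a ++ c ++ b ∈ R → b ++ a ++ c ∉ R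

namespace FormulaBFreeLanguage

variable {R : Set (List (Fin 3))}

theorem preimage (hR : FormulaBFreeLanguage R) (e : Equiv.Perm (Fin 3)) :
    FormulaBFreeLanguage {u | u.map e ∈ R} where
  nil_mem := hR.nil_mem
  of_infix h hv := hR.of_infix (h.map e) hv
  exists_concat {u} h := by
    obtain ⟨c, hc⟩ := hR.exists_concat h
    exact ⟨e.symm c, by simpa using hc⟩
  exists_cons {u} h := by
    obtain ⟨c, hc⟩ := hR.exists_cons h
    exact ⟨e.symm c, by simpa using hc⟩
  eq_nil_of_square {u} h := by
    have := hR.eq_nil_of_square (u := u.map e) (by simpa using h)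
    simpa using this
  avoids {a b c} ha hb hc h₁ h₂ h₃ h₄ := by
    refine hR.avoids (a := a.map e) (b := b.map e) (c := c.map e) ?_ ?_ ?_ ?_ ?_ ?_ ?_ <;> simp_all

theorem exists_perm : ∀ p ∈ letterPairs, ∃ e : Equiv.Perm (Fin 3), e 0 = p.1 ∧ e 1 = p.2 := by
  decide

theorem map_thirdLetter : ∀ (e : Equiv.Perm (Fin 3)), ∀ p ∈ letterPairs,
    e (thirdLetter p.1 p.2) = thirdLetter (e p.1) (e p.2) := by
  decide

/-- A property of pairs of distinct letters that is invariant under renaming of letters has to be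
shown for one pair only. -/
theorem forall_pairs {f : Fin 3 × Fin 3 → List (Fin 3)}
    (hf : ∀ e : Equiv.Perm (Fin 3), ∀ p ∈ letterPairs, (f p).map e = f (e p.1, e p.2))
    {P : Set (List (Fin 3)) → Prop}
    (hP : ∀ {R}, P R → ∀ e : Equiv.Perm (Fin 3), P {u | u.map e ∈ R})
    {Q : Prop → Prop} (h : ∀ {R}, P R → Q (f (0, 1) ∈ R)) (hR : P R) :
    ∀ p ∈ letterPairs, Q (f p ∈ R) := by
  intro p hp
  obtain ⟨e, h0, h1⟩ := exists_perm p hp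
  have := h (hP hR e)
  rwa [Set.mem_ofPred_eq, hf e (0, 1) (by decide), h0, h1] at this

theorem letter_mem (hR : FormulaBFreeLanguage R) (c : Fin 3) : [c] ∈ R := by
  by_contra h
  exact hR.not_mem_of_isDead (by simpa using h) (isDead_letter c) hR.nil_mem

theorem permutation_mem (hR : FormulaBFreeLanguage R) :
    ∀ p ∈ letterPairs, [p.1, p.2, thirdLetter p.1 p.2] ∈ R := by
  refine forall_pairs (f := fun p => [p.1, p.2, thirdLetter p.1 p.2]) (Q := id)
    (fun e p hp => by simp [map_thirdLetter e p hp]) preimage (fun {R} hR => ?_) hR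
  by_contra h
  exact hR.not_mem_of_isDead (fun b hb => by rw [List.mem_singleton.1 hb]; exact h)
    isDead_permutation (hR.letter_mem 0)

/-- Next to `bcb`, the letter `b` creates `bb`, and `c` creates `cbcb` or `bcbc`. -/
theorem thirdLetter_cons_concat_mem (hR : FormulaBFreeLanguage R) {p : Fin 3 × Fin 3}
    (hp : p ∈ letterPairs)
    (h : wordBCB p ∈ R) :
    thirdLetter p.1 p.2 :: wordBCB p ++ [thirdLetter p.1 p.2] ∈ R := by
  have key : ∀ p ∈ letterPairs, ∀ c, c = thirdLetter p.1 p.2 ∨ hasSquarePrefix (c :: wordBCB p) ∧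
      hasSquarePrefix (c :: (wordBCB p).reverse) := by decide
  obtain ⟨c, hc⟩ := hR.exists_cons h
  obtain ⟨d, hd⟩ := hR.exists_concat hc
  have h1 := hR.hasSquarePrefix_eq_false hc
  have h2 : hasSquarePrefix (d :: (wordBCB p).reverse) = false := by
    refine hR.reverse.hasSquarePrefix_eq_false (hR.of_infix (v := c :: wordBCB p ++ [d]) ?_ hd)
    exact ⟨[c], [], by simp⟩
  obtain rfl : c = thirdLetter p.1 p.2 := (key p hp c).resolve_right (by simp [h1])
  obtain rfl : d = thirdLetter p.1 p.2 := (key p hp d).resolve_right (by simp [h2])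
  exact hd

/-- Take `A = a`, `B = b`, `C = c`: the fragment `ABCBA` is the forced extension `abcba` of `bcb`,
and the fragments `ACB` and `BAC` are permutations of the letters, which are always present. -/
theorem wordABCAB_not_mem (hR : FormulaBFreeLanguage R) {p : Fin 3 × Fin 3}
    (hp : p ∈ letterPairs)
    (h : wordBCB p ∈ R) : wordABCAB p ∉ R := by
  intro h'
  have h1 := hR.thirdLetter_cons_concat_mem hp h
  have key : ∀ p ∈ letterPairs, (thirdLetter p.1 p.2, p.2) ∈ letterPairs ∧
      thirdLetter (thirdLetter p.1 p.2) p.2 = p.1 ∧ (p.1, thirdLetter p.1 p.2) ∈ letterPairs ∧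
      thirdLetter p.1 (thirdLetter p.1 p.2) = p.2 := by decide
  obtain ⟨k1, k2, k3, k4⟩ := key p hp
  have h2 := hR.permutation_mem _ k1
  have h3 := hR.permutation_mem _ k3
  simp only [k2, k4] at h2 h3
  exact hR.avoids (a := [thirdLetter p.1 p.2]) (b := [p.1]) (c := [p.2]) (by simp) (by simp)
    (by simp) h' h1 h2 h3

theorem not_mem_bansOfChoice {ch : Fin 3 × Fin 3 → Bool} {f g : Fin 3 × Fin 3 → List (Fin 3)}
    (hf : ∀ p ∈ letterPairs, ch p = true → f p ∉ R)
    (hg : ∀ p ∈ letterPairs, ch p = false → g p ∉ R) : ∀ b ∈ bansOfChoice ch f g, b ∉ R := by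
  intro b hb
  obtain ⟨p, hp, rfl⟩ := List.mem_map.1 hb
  cases h : ch p
  · simpa using hg p hp h
  · simpa using hf p hp h

theorem bansOfChoice_congr {ch ch' : Fin 3 × Fin 3 → Bool} (f g : Fin 3 × Fin 3 → List (Fin 3))
    (h : ∀ p ∈ letterPairs, ch p = ch' p) : bansOfChoice ch f g = bansOfChoice ch' f g :=
  List.map_congr_left fun p hp => by rw [h p hp]

theorem wordBCB_mem_of_meetsAllPairs (hR : FormulaBFreeLanguage R) {ch : Fin 3 × Fin 3 → Bool}
    (hch : ∀ p, ch p = true ↔ wordBCB p ∈ R) (h : meetsAllPairs ch = true) :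
    ∀ p ∈ letterPairs, wordBCB p ∈ R := by
  by_contra! hn
  obtain ⟨p, hp, hpR⟩ := hn
  have hc := choiceOfBools_eq ch
  set ch' := choiceOfBools (ch (0, 1)) (ch (0, 2)) (ch (1, 0)) (ch (1, 2)) (ch (2, 0)) (ch (2, 1))
    with hch'
  have h1 := isDead_of_meetsAllPairs (ch (0, 1)) (ch (0, 2)) (ch (1, 0)) (ch (1, 2)) (ch (2, 0))
    (ch (2, 1))
  simp only [← hch'] at h1
  have h2 : meetsAllPairs ch' = true := h
  have h3 : letterPairs.all ch' = false := by
    rw [List.all_eq_false]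
    exact ⟨p, hp, by rw [hc p hp, hch]; exact hpR⟩
  refine hR.not_mem_of_isDead (not_mem_bansOfChoice ?_ ?_) (h1 h2 h3) ?_
  · intro q hq hq'
    exact hR.wordABCAB_not_mem hq ((hch q).1 (hc q hq ▸ hq'))
  · intro q hq hq'
    rw [← hch, ← hc q hq, hq']
    simp
  -- The default start `[]` is harmless, since the empty word lies in `R`.
  · cases hfind : letterPairs.find? ch' with
    | none => exact hR.nil_mem
    | some q =>
      have hq := List.mem_of_find?_eq_some hfind
      exact (hch q).1 (hc q hq ▸ List.find?_some hfind)

/-- The language contains all words `aba`. -/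
def IsFull (R : Set (List (Fin 3))) : Prop :=
  FormulaBFreeLanguage R ∧ ∀ p ∈ letterPairs, wordBCB p ∈ R

theorem IsFull.preimage {R : Set (List (Fin 3))} (hR : IsFull R) (e : Equiv.Perm (Fin 3)) :
    IsFull {u | u.map e ∈ R} := by
  refine ⟨hR.1.preimage e, fun p hp => ?_⟩
  exact hR.2 (e p.1, e p.2) (mem_letterPairs.2 fun h => mem_letterPairs.1 hp (e.injective h))

theorem IsFull.wordABCAB_not_mem {R : Set (List (Fin 3))} (hR : IsFull R) :
    ∀ b ∈ letterPairs.map wordABCAB, b ∉ R := by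
  intro b hb
  obtain ⟨p, hp, rfl⟩ := List.mem_map.1 hb
  exact hR.1.wordABCAB_not_mem hp (hR.2 p hp)

theorem IsFull.longACB_mem {R : Set (List (Fin 3))} (hR : IsFull R) :
    ∀ p ∈ letterPairs, longACB p ∈ R := by
  refine forall_pairs (Q := id) (fun e p hp => by simp [longACB, map_thirdLetter e p hp])
    IsFull.preimage (fun {R} hR => ?_) hR
  by_contra h
  exact hR.1.not_mem_of_isDead (List.forall_mem_cons.2 ⟨h, hR.wordABCAB_not_mem⟩) isDead_longACB
    (hR.2 (0, 1) (by decide))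

theorem IsFull.longBAC_mem {R : Set (List (Fin 3))} (hR : IsFull R) :
    ∀ p ∈ letterPairs, longBAC p ∈ R := by
  refine forall_pairs (Q := id) (fun e p hp => by simp [longBAC, map_thirdLetter e p hp])
    IsFull.preimage (fun {R} hR => ?_) hR
  by_contra h
  exact hR.1.not_mem_of_isDead (List.forall_mem_cons.2 ⟨h, hR.wordABCAB_not_mem⟩) isDead_longBAC
    (hR.2 (0, 1) (by decide))

theorem IsFull.longABCBA_not_mem {R : Set (List (Fin 3))} (hR : IsFull R) {p : Fin 3 × Fin 3}
    (hp : p ∈ letterPairs) (h : longABCAB p ∈ R) : longABCBA p ∉ R := fun h' =>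
  hR.1.avoids (a := [p.1, p.2]) (b := [thirdLetter p.1 p.2]) (c := [p.1, thirdLetter p.1 p.2, p.2])
    (by simp) (by simp) (by simp) h h' (hR.longACB_mem p hp) (hR.longBAC_mem p hp)

theorem IsFull.longABCAB_not_mem {R : Set (List (Fin 3))} (hR : IsFull R) :
    ∀ p ∈ letterPairs, longABCAB p ∉ R := by
  refine forall_pairs (Q := Not) (fun e p hp => by simp [longABCAB, map_thirdLetter e p hp])
    IsFull.preimage (fun {R} hR h => ?_) hR
  classical
  let ch : Fin 3 × Fin 3 → Bool := fun p => decide (longABCAB p ∈ R)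
  have h0 : ch (0, 1) = true := by simpa [ch] using h
  have h1 := isDead_longABCAB (ch (0, 2)) (ch (1, 0)) (ch (1, 2)) (ch (2, 0)) (ch (2, 1))
  have h2 := choiceOfBools_eq ch
  rw [h0] at h2
  rw [bansOfChoice_congr _ _ h2] at h1
  refine hR.1.not_mem_of_isDead (List.forall_mem_append.2
    ⟨not_mem_bansOfChoice ?_ ?_, hR.wordABCAB_not_mem⟩) h1 h
  · exact fun p hp hp' => hR.longABCBA_not_mem hp (by simpa [ch] using hp')
  · exact fun p hp hp' => by simpa [ch] using hp'

/-- With every `longABCAB` and every `abcab` excluded, `010` has no long extensions, yet it is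
present by fullness. -/
theorem not_isFull (hR : IsFull R) : False := by
  refine hR.1.not_mem_of_isDead (List.forall_mem_append.2 ⟨?_, hR.wordABCAB_not_mem⟩)
    isDead_forall_longABCAB (hR.2 (0, 1) (by decide))
  intro b hb
  obtain ⟨p, hp, rfl⟩ := List.mem_map.1 hb
  exact hR.longABCAB_not_mem p hp

theorem exists_avoided_pair (hR : FormulaBFreeLanguage R) :
    ([0, 1, 0] ∉ R ∧ [2, 1, 2] ∉ R) ∨ ([0, 2, 0] ∉ R ∧ [1, 2, 1] ∉ R) ∨
      ([1, 0, 1] ∉ R ∧ [2, 0, 2] ∉ R) := by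
  classical
  by_contra hn
  refine not_isFull ⟨hR, hR.wordBCB_mem_of_meetsAllPairs
    (ch := fun p => decide (wordBCB p ∈ R)) (fun p => by simp) ?_⟩
  simp only [meetsAllPairs, Bool.and_eq_true, Bool.or_eq_true, decide_eq_true_eq]
  simp only [wordBCB]
  tauto

end FormulaBFreeLanguage

/-! ### The Thue–Morse word and `b3` as its difference word -/

open Filter

/-- The Thue–Morse word: the parity of the number of binary digits `1`. -/
def thueMorse (n : ℕ) : Bool := n.bits.foldr xor false

theorem thueMorse_bit (b : Bool) (n : ℕ) : thueMorse (Nat.bit b n) = xor b (thueMorse n) := by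
  by_cases h : n = 0 → b = true
  · rw [thueMorse, Nat.bits_append_bit n b h, List.foldr_cons, thueMorse]
  · push Not at h
    obtain ⟨rfl, hb⟩ := h
    cases b
    · rfl
    · simp at hb

theorem thueMorse_two_mul (n : ℕ) : thueMorse (2 * n) = thueMorse n := by
  simpa [Nat.bit_false] using thueMorse_bit false n

theorem thueMorse_two_mul_add_one (n : ℕ) : thueMorse (2 * n + 1) = !thueMorse n := by
  simpa [Nat.bit_true] using thueMorse_bit true n

theorem thueMorse_zero : thueMorse 0 = false := rfl

/-- The letter that codes two consecutive bits by their difference. -/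
def diffLetter : Bool → Bool → Fin 3
  | false, true => 0
  | true, false => 2
  | _, _ => 1

/-- The ternary word of the differences of a binary word. -/
def diffWord (s : InfWord Bool) : InfWord (Fin 3) :=
  fun n => diffLetter (s n) (s (n + 1))

theorem morphImage_append {α β : Type*} (h : α → List β) (u v : List α) :
    morphImage h (u ++ v) = morphImage h u ++ morphImage h v :=
  List.flatMap_append

namespace InfWord

variable {α β : Type*}

theorem factorAt_add (w : InfWord α) (i m n : ℕ) :
    w.factorAt i (m + n) = w.factorAt i m ++ w.factorAt (i + m) n := by
  simp only [factorAt, List.ofFn_add, Fin.val_castLE, Fin.val_natAdd, Nat.add_assoc]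

theorem length_factorAt (w : InfWord α) (i n : ℕ) : (w.factorAt i n).length = n := by
  simp [factorAt]

theorem occursAt_factorAt (w : InfWord α) (i n : ℕ) : w.OccursAt (w.factorAt i n) i := by
  rw [OccursAt, length_factorAt]

theorem occursAt_append {w : InfWord α} {u v : List α} {i : ℕ} :
    w.OccursAt (u ++ v) i ↔ w.OccursAt u i ∧ w.OccursAt v (i + u.length) := by
  rw [OccursAt, List.length_append, factorAt_add]
  constructor
  · intro h
    exact List.append_inj h (w.length_factorAt _ _)
  · rintro ⟨h1, h2⟩
    rw [h1, h2]

theorem occursAt_singleton {w : InfWord α} {a : α} {i : ℕ} : w.OccursAt [a] i ↔ w i = a := by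
  simp [OccursAt, factorAt]

theorem occursAt_cons {w : InfWord α} {a : α} {u : List α} {i : ℕ} :
    w.OccursAt (a :: u) i ↔ w i = a ∧ w.OccursAt u (i + 1) := by
  rw [← List.singleton_append, occursAt_append, occursAt_singleton, List.length_singleton]

theorem occursAt_nil (w : InfWord α) (i : ℕ) : w.OccursAt [] i := rfl

theorem OccursAt.infix {w : InfWord α} {u v : List α} {i : ℕ} (h : w.OccursAt v i)
    (huv : u <:+: v) : u ∈ w.factors := by
  obtain ⟨s, t, rfl⟩ := huv
  exact ⟨_, (occursAt_append.1 (occursAt_append.1 h).1).2⟩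

theorem occursAt_map {g : α → β} (hg : Function.Injective g) {w : InfWord α} {u : List α} {i : ℕ} :
    (w.map g).OccursAt (u.map g) i ↔ w.OccursAt u i := by
  simp [occursAt_iff, InfWord.map, hg.eq_iff]

end InfWord

theorem diffWord_thueMorse : diffWord thueMorse = b3 := by
  rw [← isFixedPoint_thueMorphism_iff]
  -- The image of a letter has length two plus the increment of the bits that it codes (3, 2, 1 for
  -- an ascent, an equality, a descent), so the lengths telescope. The image of letter `n` thus
  -- starts at position `2 * n` or `2 * n + 1` according to bit `n`.
  have key : ∀ n, (morphImage thueMorphism ((diffWord thueMorse).factorAt 0 n)).length =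
      2 * n + (thueMorse n).toNat ∧
      (diffWord thueMorse).OccursAt
        (morphImage thueMorphism ((diffWord thueMorse).factorAt 0 n)) 0 := by
    intro n
    induction n with
    | zero => exact ⟨rfl, rfl⟩
    | succ n ih =>
      have h1 : (diffWord thueMorse).factorAt 0 (n + 1) =
          (diffWord thueMorse).factorAt 0 n ++ [diffWord thueMorse n] := by
        rw [InfWord.factorAt_add]
        simp [InfWord.factorAt]
      have h2 : morphImage thueMorphism [diffWord thueMorse n] =
          thueMorphism (diffWord thueMorse n) := by simp [morphImage]
      rw [h1, morphImage_append, List.length_append, InfWord.occursAt_append, ih.1, h2]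
      have e0 := thueMorse_two_mul n
      have e1 := thueMorse_two_mul_add_one n
      have e2 : thueMorse (2 * n + 1 + 1) = thueMorse (n + 1) := thueMorse_two_mul (n + 1)
      have e3 : thueMorse (2 * n + 1 + 1 + 1) = !thueMorse (n + 1) :=
        thueMorse_two_mul_add_one (n + 1)
      refine ⟨?_, ih.2, ?_⟩
      · cases h : thueMorse n <;> cases h' : thueMorse (n + 1) <;>
          simp [diffWord, h, h', diffLetter, thueMorphism] <;> omega
      · cases h : thueMorse n <;> cases h' : thueMorse (n + 1) <;>
          simp [diffWord, h, h', diffLetter, thueMorphism, InfWord.occursAt_cons,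
            InfWord.occursAt_nil, e0, e1, e2, e3]
  exact fun n => (key n).2

/-! ### Desubstitution of eventually overlap-free binary words -/

/-- For each period, the overlaps with this period appear only finitely many times. -/
def EventuallyOverlapFree (s : InfWord Bool) : Prop :=
  ∀ p > 0, ∀ᶠ i in atTop, ∃ k ≤ p, s (i + k) ≠ s (i + p + k)

/-- Excluding overlaps of periods 1, 2 and 3 forces equal adjacent bits to start at positions of a
single parity. Cutting right after the first bit of one such pair leaves blocks of two distinct
bits. An overlap of period `p` in the preimage gives one of period `2 * p` in `s`. -/
theorem EventuallyOverlapFree.exists_desubstitution {s : InfWord Bool}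
    (hs : EventuallyOverlapFree s) : ∃ (p : ℕ) (s' : InfWord Bool), EventuallyOverlapFree s' ∧
      ∀ n, s (p + 2 * n) = s' n ∧ s (p + (2 * n + 1)) = !s' n := by
  obtain ⟨N, hN⟩ := eventually_atTop.1 ((hs 1 (by decide)).and ((hs 2 (by decide)).and
    (hs 3 (by decide))))
  have o1 : ∀ i ≥ N, ¬ (s i = s (i + 1) ∧ s (i + 1) = s (i + 2)) := by
    rintro i hi ⟨h1, h2⟩
    obtain ⟨k, hk, h⟩ := (hN i hi).1
    interval_cases k <;> simp_all [Nat.add_assoc]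
  have o2 : ∀ i ≥ N, ¬ (s i = s (i + 2) ∧ s (i + 1) = s (i + 3) ∧ s (i + 2) = s (i + 4)) := by
    rintro i hi ⟨h1, h2, h3⟩
    obtain ⟨k, hk, h⟩ := (hN i hi).2.1
    interval_cases k <;> simp_all [Nat.add_assoc]
  have o3 : ∀ i ≥ N, ¬ (s i = s (i + 3) ∧ s (i + 1) = s (i + 4) ∧ s (i + 2) = s (i + 5) ∧
      s (i + 3) = s (i + 6)) := by
    rintro i hi ⟨h1, h2, h3, h4⟩
    obtain ⟨k, hk, h⟩ := (hN i hi).2.2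
    interval_cases k <;> simp_all [Nat.add_assoc]
  have odd : ∀ n i, N + 1 ≤ i → s i = s (i + 1) → s (i + 2 * n + 1) ≠ s (i + 2 * n + 2) := by
    intro n
    induction n using Nat.strong_induction_on with
    | _ n ih =>
      intro i hi hd
      -- The bit before the equal pair is needed for the overlap of period 3, hence the bound `N +
      -- 1`.
      obtain ⟨j, rfl⟩ : ∃ j, i = j + 1 := ⟨i - 1, by omega⟩
      match n, ih with
      | 0, _ =>
        intro h
        exact o1 (j + 1) (by omega) ⟨hd, h⟩
      | 1, _ =>
        have a1 := o1 j (by omega)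
        have a2 := o1 (j + 1) (by omega)
        have a4 := o1 (j + 3) (by omega)
        have a5 := o1 (j + 4) (by omega)
        have a6 := o3 j (by omega)
        simp only [Nat.add_assoc, Nat.reduceAdd, Nat.reduceMul] at hd a1 a2 a4 a5 a6 ⊢
        revert hd a1 a2 a4 a5 a6
        generalize s j = x0
        generalize s (j + 1) = x1
        generalize s (j + 2) = x2
        generalize s (j + 3) = x3
        generalize s (j + 4) = x4
        generalize s (j + 5) = x5
        generalize s (j + 6) = x6
        cases x0 <;> cases x1 <;> cases x2 <;> cases x3 <;> cases x4 <;> cases x5 <;> cases x6 <;>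
          simp
      | n + 2, ih =>
        -- Another equal pair starts at distance 2 or 4 from the first. If not at 2, the bits
        -- alternate from distance 1 to 4, and avoiding `ababa` forces equality of those at
        -- distances 4 and 5.
        by_cases h2 : s (j + 1 + 2) = s (j + 1 + 3)
        · have := ih (n + 1) (by omega) (j + 1 + 2) (by omega) h2
          convert this using 2 <;> ring
        · have a1 := ih 1 (by omega) (j + 1) hi hd
          have a0 := o1 (j + 1) (by omega)
          have a2 := o2 (j + 2) (by omega)
          have h4 : s (j + 1 + 4) = s (j + 1 + 5) := by
            simp only [Nat.add_assoc, Nat.reduceAdd, Nat.reduceMul] at hd h2 a0 a1 a2 ⊢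
            revert hd h2 a0 a1 a2
            generalize s (j + 1) = x1
            generalize s (j + 2) = x2
            generalize s (j + 3) = x3
            generalize s (j + 4) = x4
            generalize s (j + 5) = x5
            generalize s (j + 6) = x6
            revert x1 x2 x3 x4 x5 x6
            decide
          have := ih n (by omega) (j + 1 + 4) (by omega) h4
          convert this using 2 <;> ring
  obtain ⟨i, hi, hd⟩ : ∃ i, N + 1 ≤ i ∧ s i = s (i + 1) := by
    by_contra! h
    refine o2 (N + 1) (by omega) ?_
    have h0 := h (N + 1) le_rfl
    have h1 := h (N + 2) (by omega)
    have h2 := h (N + 3) (by omega)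
    have h3 := h (N + 4) (by omega)
    simp only [Nat.add_assoc, Nat.reduceAdd] at h0 h1 h2 h3 ⊢
    revert h0 h1 h2 h3
    generalize s (N + 1) = x1
    generalize s (N + 2) = x2
    generalize s (N + 3) = x3
    generalize s (N + 4) = x4
    generalize s (N + 5) = x5
    revert x1 x2 x3 x4 x5
    decide
  have hpair : ∀ n, s (i + 1 + (2 * n + 1)) = !s (i + 1 + 2 * n) := by
    intro n
    have := odd n i hi hd
    rw [show i + 1 + (2 * n + 1) = i + 2 * n + 2 by ring,
      show i + 1 + 2 * n = i + 2 * n + 1 by ring]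
    exact Bool.eq_not.2 this.symm
  refine ⟨i + 1, fun n => s (i + 1 + 2 * n), fun p hp => ?_, fun n => ⟨rfl, hpair n⟩⟩
  obtain ⟨M, hM⟩ := eventually_atTop.1 (hs (2 * p) (by omega))
  refine eventually_atTop.2 ⟨M, fun m hm => ?_⟩
  obtain ⟨k, hk, h⟩ := hM (i + 1 + 2 * m) (by omega)
  obtain ⟨j, rfl | rfl⟩ := Nat.even_or_odd' k
  · refine ⟨j, by omega, ?_⟩
    convert h using 2 <;> ring
  · refine ⟨j, by omega, fun h' => h ?_⟩
    replace h' : s (i + 1 + 2 * (m + j)) = s (i + 1 + 2 * (m + p + j)) := h'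
    have e1 := hpair (m + j)
    have e2 := hpair (m + p + j)
    rw [show i + 1 + 2 * m + (2 * j + 1) = i + 1 + (2 * (m + j) + 1) by ring,
      show i + 1 + 2 * m + 2 * p + (2 * j + 1) = i + 1 + (2 * (m + p + j) + 1) by ring, e1, e2, h']

theorem EventuallyOverlapFree.exists_iterate_desubstitution {s : InfWord Bool}
    (hs : EventuallyOverlapFree s) (k : ℕ) : ∃ (p : ℕ) (s' : InfWord Bool),
      EventuallyOverlapFree s' ∧
      ∀ n, ∀ r < 2 ^ k, s (p + (2 ^ k * n + r)) = xor (s' n) (thueMorse r) := by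
  induction k generalizing s with
  | zero => exact ⟨0, s, hs, fun n r hr => by
      obtain rfl : r = 0 := by simpa using hr
      simp [thueMorse_zero]⟩
  | succ k ih =>
    obtain ⟨q, s₁, hs₁, h₁⟩ := hs.exists_desubstitution
    obtain ⟨p, s', hs', h'⟩ := ih hs₁
    refine ⟨q + 2 * p, s', hs', fun n r hr => ?_⟩
    obtain ⟨j, rfl | rfl⟩ := Nat.even_or_odd' r
    · have e : q + 2 * p + (2 ^ (k + 1) * n + 2 * j) = q + 2 * (p + (2 ^ k * n + j)) := by ring
      rw [e, (h₁ _).1, h' n j (by omega), thueMorse_two_mul]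
    · have e : q + 2 * p + (2 ^ (k + 1) * n + (2 * j + 1)) =
          q + (2 * (p + (2 ^ k * n + j)) + 1) := by ring
      rw [e, (h₁ _).2, h' n j (by omega), thueMorse_two_mul_add_one, Bool.xor_not]

theorem thueMorse_pow_mul_add (k n : ℕ) : ∀ r < 2 ^ k,
    thueMorse (2 ^ k * n + r) = xor (thueMorse n) (thueMorse r) := by
  induction k with
  | zero =>
    intro r hr
    obtain rfl : r = 0 := by simpa using hr
    simp [thueMorse_zero]
  | succ k ih =>
    intro r hr
    obtain ⟨j, rfl | rfl⟩ := Nat.even_or_odd' r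
    · rw [show 2 ^ (k + 1) * n + 2 * j = 2 * (2 ^ k * n + j) by ring, thueMorse_two_mul,
        ih j (by omega), thueMorse_two_mul]
    · rw [show 2 ^ (k + 1) * n + (2 * j + 1) = 2 * (2 ^ k * n + j) + 1 by ring,
        thueMorse_two_mul_add_one, ih j (by omega), thueMorse_two_mul_add_one, Bool.xor_not]

theorem exists_consecutive_thueMorse :
    ∀ x y : Bool, ∃ m, thueMorse m = x ∧ thueMorse (m + 1) = y := by
  rintro (_ | _) (_ | _)
  exacts [⟨5, rfl, rfl⟩, ⟨0, rfl, rfl⟩, ⟨2, rfl, rfl⟩, ⟨1, rfl, rfl⟩]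

theorem frequently_thueMorse_eq_false : ∃ᶠ n in atTop, thueMorse n = false := by
  refine frequently_atTop.2 fun N => ?_
  cases h : thueMorse N
  · exact ⟨N, le_rfl, h⟩
  · exact ⟨2 * N + 1, by omega, by rw [thueMorse_two_mul_add_one, h]; rfl⟩

/-- Otherwise `s` is eventually constant, which gives overlaps of period 1. -/
theorem EventuallyOverlapFree.frequently_eq_false {s : InfWord Bool}
    (hs : EventuallyOverlapFree s) : ∃ᶠ n in atTop, s n = false := by
  refine fun h => ?_
  obtain ⟨n, ⟨k, hk, hne⟩, h1, h2, h3⟩ := ((hs 1 one_pos).and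
    (h.and (((tendsto_add_atTop_nat 1).eventually h).and
    ((tendsto_add_atTop_nat 2).eventually h)))).exists
  interval_cases k <;> simp_all [Nat.add_assoc]

theorem InfWord.mem_recurrentFactors_iff {α : Type*} {w : InfWord α} {u : List α} :
    u ∈ w.recurrentFactors ↔ ∃ᶠ i in atTop, w.OccursAt u i :=
  Nat.frequently_atTop_iff_infinite.symm

theorem InfWord.recurrentFactors_subset_factors {α : Type*} (w : InfWord α) :
    w.recurrentFactors ⊆ w.factors :=
  fun _ h => Set.Infinite.nonempty h

/-- If for each `k` some suffix of `s` consists of blocks of length `2 ^ k` that are prefixes of the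
Thue–Morse word or their complements, and if the former appear infinitely many times, then all
factors of `b₃` are recurrent in the difference word. -/
theorem factors_b3_subset_recurrentFactors {s : InfWord Bool}
    (h : ∀ k, ∃ (p : ℕ) (s' : InfWord Bool), (∃ᶠ n in atTop, s' n = false) ∧
      ∀ n, ∀ r < 2 ^ k, s (p + (2 ^ k * n + r)) = xor (s' n) (thueMorse r)) :
    b3.factors ⊆ (diffWord s).recurrentFactors := by
  rintro u ⟨i, hi⟩
  rw [← diffWord_thueMorse, InfWord.occursAt_iff] at hi
  obtain ⟨p, s', hs', h⟩ := h (i + u.length + 1)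
  have hlt : i + u.length + 1 < 2 ^ (i + u.length + 1) := Nat.lt_two_pow_self
  rw [InfWord.mem_recurrentFactors_iff, frequently_atTop]
  intro N
  obtain ⟨n, hn, hn'⟩ := frequently_atTop.1 hs' N
  refine ⟨p + (2 ^ (i + u.length + 1) * n + i), ?_, ?_⟩
  · have := Nat.le_mul_of_pos_left n (Nat.two_pow_pos (i + u.length + 1))
    omega
  · rw [InfWord.occursAt_iff]
    intro k hk
    rw [← hi k hk, diffWord, diffWord]
    have e1 := h n (i + k) (by omega)
    have e2 := h n (i + k + 1) (by omega)
    rw [hn', Bool.false_xor] at e1 e2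
    rw [← e1, ← e2]
    simp only [Nat.add_assoc]

/-- The `u.length + 1` bits that code `u` meet at most two consecutive blocks of length `2 ^
(u.length + 1)`. All four pairs of consecutive bits occur in the Thue–Morse word, so the same two
blocks are adjacent there. -/
theorem EventuallyOverlapFree.recurrentFactors_subset {s : InfWord Bool}
    (hs : EventuallyOverlapFree s) : (diffWord s).recurrentFactors ⊆ b3.factors := by
  intro u hu
  obtain ⟨p, s', -, h⟩ := hs.exists_iterate_desubstitution (u.length + 1)
  have hlt : u.length + 1 < 2 ^ (u.length + 1) := Nat.lt_two_pow_self
  obtain ⟨i, hi, hu⟩ := frequently_atTop.1 (InfWord.mem_recurrentFactors_iff.1 hu) p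
  set K := 2 ^ (u.length + 1)
  obtain ⟨n, r, hr, rfl⟩ : ∃ n r, r < K ∧ i = p + (K * n + r) :=
    ⟨(i - p) / K, (i - p) % K, Nat.mod_lt _ (by omega), by
      rw [Nat.div_add_mod]; omega⟩
  obtain ⟨m, h1, h2⟩ := exists_consecutive_thueMorse (s' n) (s' (n + 1))
  refine ⟨K * m + r, ?_⟩
  have key : ∀ k ≤ u.length, s (p + (K * n + r) + k) = thueMorse (K * m + r + k) := by
    intro k hk
    by_cases hrk : r + k < K
    · rw [Nat.add_assoc p, Nat.add_assoc (K * n), h n _ hrk, Nat.add_assoc (K * m),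
        thueMorse_pow_mul_add _ _ _ hrk, h1]
    · have e1 : p + (K * n + r) + k = p + (K * (n + 1) + (r + k - K)) := by
        rw [Nat.mul_succ]; omega
      have e2 : K * m + r + k = K * (m + 1) + (r + k - K) := by
        rw [Nat.mul_succ]; omega
      rw [e1, e2, h (n + 1) _ (by omega), thueMorse_pow_mul_add _ _ _ (by omega), h2]
  rw [← diffWord_thueMorse]
  rw [InfWord.occursAt_iff] at hu ⊢
  intro k hk
  rw [← hu k hk]
  exact (congrArg₂ diffLetter (key k hk.le) (key (k + 1) hk)).symm

theorem b3_recurrentFactors : b3.recurrentFactors = b3.factors := by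
  refine b3.recurrentFactors_subset_factors.antisymm ?_
  have := factors_b3_subset_recurrentFactors (s := thueMorse) fun k =>
    ⟨0, thueMorse, frequently_thueMorse_eq_false, fun n r hr => by
      rw [Nat.zero_add, thueMorse_pow_mul_add _ _ _ hr]⟩
  rwa [diffWord_thueMorse] at this

theorem EventuallyOverlapFree.recurrentFactors_eq {s : InfWord Bool}
    (hs : EventuallyOverlapFree s) : (diffWord s).recurrentFactors = b3.factors :=
  hs.recurrentFactors_subset.antisymm <| factors_b3_subset_recurrentFactors fun k => by
    obtain ⟨p, s', hs', h⟩ := hs.exists_iterate_desubstitution k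
    exact ⟨p, s', hs'.frequently_eq_false, h⟩

/-! ### Recurrent factors -/

namespace InfWord

variable {α : Type*}

theorem eventually_not_occursAt {w : InfWord α} {u : List α} (h : u ∉ w.recurrentFactors) :
    ∀ᶠ i in atTop, ¬ w.OccursAt u i := by
  rwa [mem_recurrentFactors_iff, not_frequently] at h

/-- There are finitely many words of length `n`, and each non-recurrent one occurs only finitely
often. -/
theorem eventually_factorAt_mem [Finite α] (w : InfWord α) (n : ℕ) :
    ∀ᶠ i in atTop, w.factorAt i n ∈ w.recurrentFactors := by
  have h : ∀ᶠ i in atTop, ∀ f : Fin n → α,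
      List.ofFn f ∈ w.recurrentFactors ∨ ¬ w.OccursAt (List.ofFn f) i := by
    rw [eventually_all]
    intro f
    by_cases hf : List.ofFn f ∈ w.recurrentFactors
    · exact Eventually.of_forall fun _ => Or.inl hf
    · exact (eventually_not_occursAt hf).mono fun _ hi => Or.inr hi
  exact h.mono fun i hi => (hi _).resolve_right fun hn => hn (w.occursAt_factorAt i n)

theorem recurrentFactors_congr {v w : InfWord α} (h : ∀ᶠ i in atTop, v i = w i) :
    v.recurrentFactors = w.recurrentFactors := by
  have key : ∀ {v w : InfWord α}, (∀ᶠ i in atTop, v i = w i) →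
      v.recurrentFactors ⊆ w.recurrentFactors := by
    intro v w h u hu
    obtain ⟨N, hN⟩ := eventually_atTop.1 h
    rw [mem_recurrentFactors_iff] at hu ⊢
    refine (hu.and_eventually (eventually_ge_atTop N)).mono fun i hi => ?_
    rw [occursAt_iff] at hi ⊢
    intro k hk
    rw [← hN (i + k) (by omega), hi.1 k hk]
  exact (key h).antisymm (key (h.mono fun _ => Eq.symm))

theorem mem_recurrentFactors_of_infix {w : InfWord α} {u v : List α} (huv : u <:+: v)
    (hv : v ∈ w.recurrentFactors) : u ∈ w.recurrentFactors := by
  obtain ⟨s, t, rfl⟩ := huv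
  rw [mem_recurrentFactors_iff, frequently_atTop] at hv ⊢
  intro N
  obtain ⟨i, hi, h⟩ := hv N
  exact ⟨i + s.length, by omega, (occursAt_append.1 (occursAt_append.1 h).1).2⟩

theorem exists_concat_mem_recurrentFactors [Finite α] {w : InfWord α} {u : List α}
    (hu : u ∈ w.recurrentFactors) : ∃ c, u ++ [c] ∈ w.recurrentFactors := by
  obtain ⟨i, hi, h⟩ := ((mem_recurrentFactors_iff.1 hu).and_eventually
    (w.eventually_factorAt_mem (u.length + 1))).exists
  rw [factorAt_add, show w.factorAt i u.length = u from hi] at h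
  exact ⟨w (i + u.length), by simpa [factorAt] using h⟩

theorem exists_cons_mem_recurrentFactors [Finite α] {w : InfWord α} {u : List α}
    (hu : u ∈ w.recurrentFactors) : ∃ c, c :: u ∈ w.recurrentFactors := by
  obtain ⟨N, hN⟩ := eventually_atTop.1 (w.eventually_factorAt_mem (1 + u.length))
  obtain ⟨i, hi, h⟩ := frequently_atTop.1 (mem_recurrentFactors_iff.1 hu) (N + 1)
  obtain ⟨j, rfl⟩ : ∃ j, i = j + 1 := ⟨i - 1, by omega⟩
  have h1 := hN j (by omega)
  rw [factorAt_add, show w.factorAt (j + 1) u.length = u from h] at h1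
  exact ⟨w j, by simpa [factorAt] using h1⟩

theorem recurrentFactors_map {α β : Type*} (e : α ≃ β) (w : InfWord α) :
    (w.map e).recurrentFactors = {u | u.map e.symm ∈ w.recurrentFactors} := by
  ext u
  rw [Set.mem_ofPred_eq, mem_recurrentFactors_iff, mem_recurrentFactors_iff]
  simp_rw [← occursAt_map e.injective (w := w), List.map_map, Equiv.self_comp_symm, List.map_id]

theorem factors_map {α β : Type*} (e : α ≃ β) (w : InfWord α) :
    (w.map e).factors = {u | u.map e.symm ∈ w.factors} := by
  ext u
  simp_rw [factors, Set.mem_ofPred_eq, ← occursAt_map e.injective (w := w), List.map_map,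
    Equiv.self_comp_symm, List.map_id]

theorem map_map_of_involutive {g : α → α} (hg : Function.Involutive g) (w : InfWord α) :
    (w.map g).map g = w :=
  funext fun n => hg (w n)

end InfWord

/-! ### From ternary words to binary words -/

/-- The bit that precedes the letter `w n` if `w` is a difference word. -/
def precedingBit (w : InfWord (Fin 3)) : InfWord Bool :=
  fun n => decide (w n = 2 ∨ w n = 1 ∧ w (n + 1) = 2)

/-- Apart from finitely many letters, a word whose recurrent factors are square-free and different
from `010` and `212` is a difference word. -/
theorem eventually_diffWord_precedingBit {w : InfWord (Fin 3)}
    (hsq : ∀ u, u ++ u ∈ w.recurrentFactors → u = [])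
    (h010 : [0, 1, 0] ∉ w.recurrentFactors) (h212 : [2, 1, 2] ∉ w.recurrentFactors) :
    ∀ᶠ i in atTop, diffWord (precedingBit w) i = w i := by
  have hcc : ∀ c : Fin 3, ∀ᶠ i in atTop, ¬ w.OccursAt [c, c] i := fun c =>
    InfWord.eventually_not_occursAt fun h => by simpa using hsq [c] h
  obtain ⟨N, hN⟩ := eventually_atTop.1 ((eventually_all.2 hcc).and
    ((InfWord.eventually_not_occursAt h010).and (InfWord.eventually_not_occursAt h212)))
  have key : ∀ a b c : Fin 3,
      diffLetter (decide (a = 2 ∨ a = 1 ∧ b = 2)) (decide (b = 2 ∨ b = 1 ∧ c = 2)) = a ∨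
        a = b ∨ b = c ∨ (a = 0 ∧ b = 1 ∧ c = 0) ∨ (a = 2 ∧ b = 1 ∧ c = 2) := by
    decide
  refine eventually_atTop.2 ⟨N, fun i hi => ?_⟩
  rcases key (w i) (w (i + 1)) (w (i + 2)) with h | h | h | h | h
  · exact h
  · exact absurd (by simp [InfWord.occursAt_cons, InfWord.occursAt_nil, ← h])
      ((hN i hi).1 (w i))
  · exact absurd (by simp [InfWord.occursAt_cons, InfWord.occursAt_nil, ← h])
      ((hN (i + 1) (by omega)).1 (w (i + 1)))
  · exact absurd (by simpa [InfWord.occursAt_cons, InfWord.occursAt_nil] using h) (hN i hi).2.1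
  · exact absurd (by simpa [InfWord.occursAt_cons, InfWord.occursAt_nil] using h) (hN i hi).2.2

/-- An overlap of period `p` in the bits is `p + 1` equalities, hence `p` equalities of differences:
a square in `w`. Far to the right all factors of length `2p` are recurrent, so this cannot happen.
-/
theorem recurrentFactors_eq_of_squareFree {w : InfWord (Fin 3)}
    (hsq : ∀ u, u ++ u ∈ w.recurrentFactors → u = [])
    (h010 : [0, 1, 0] ∉ w.recurrentFactors) (h212 : [2, 1, 2] ∉ w.recurrentFactors) :
    w.recurrentFactors = b3.factors := by
  have hw := eventually_diffWord_precedingBit hsq h010 h212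
  rw [← InfWord.recurrentFactors_congr hw]
  refine EventuallyOverlapFree.recurrentFactors_eq fun p hp => ?_
  have hmem := (w.eventually_factorAt_mem (p + p))
  obtain ⟨N, hN⟩ := eventually_atTop.1 hw
  refine (hmem.and (eventually_ge_atTop N)).mono fun i ⟨hi, hNi⟩ => ?_
  by_contra! hover
  have hrep : w.factorAt (i + p) p = w.factorAt i p := by
    refine congrArg List.ofFn (funext fun k => ?_)
    rw [← hN (i + p + k) (by omega), ← hN (i + k) (by omega)]
    exact (congrArg₂ diffLetter (hover k (by omega)) (hover (k + 1) (by omega))).symm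
  rw [InfWord.factorAt_add, hrep] at hi
  have := congrArg List.length (hsq _ hi)
  rw [InfWord.length_factorAt, List.length_nil] at this
  omega

/-! ### Words avoiding `formulaB` -/

theorem not_isOccurrence_of_avoids {w : InfWord (Fin 3)} (hw : w.Avoids formulaB)
    {a b c : List (Fin 3)} (ha : a ≠ []) (hb : b ≠ []) (hc : c ≠ [])
    (h₁ : a ++ b ++ c ++ a ++ b ∈ w.factors) (h₂ : a ++ b ++ c ++ b ++ a ∈ w.factors)
    (h₃ : a ++ c ++ b ∈ w.factors) : b ++ a ++ c ∉ w.factors := by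
  intro h₄
  refine hw ⟨fun X => match X with | .A => a | .B => b | .C => c, ?_, ?_⟩
  · rintro (_ | _ | _) <;> assumption
  · intro p hp
    simp only [formulaB, List.mem_cons, List.not_mem_nil, or_false] at hp
    rw [List.append_assoc, List.append_assoc, List.append_assoc] at h₁ h₂
    rw [List.append_assoc] at h₃ h₄
    rcases hp with rfl | rfl | rfl | rfl <;> simpa [morphImage]

theorem formulaBFreeLanguage_of_avoids {w : InfWord (Fin 3)} (hw : w.Avoids formulaB) :
    FormulaBFreeLanguage w.recurrentFactors where
  nil_mem := InfWord.mem_recurrentFactors_iff.2 (Frequently.of_forall fun i => w.occursAt_nil i)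
  of_infix := InfWord.mem_recurrentFactors_of_infix
  exists_concat := InfWord.exists_concat_mem_recurrentFactors
  exists_cons := InfWord.exists_cons_mem_recurrentFactors
  eq_nil_of_square {u} hu := by
    by_contra hne
    have hu' := frequently_atTop.1 (InfWord.mem_recurrentFactors_iff.1 hu)
    obtain ⟨i, -, hi⟩ := hu' 0
    obtain ⟨j, hj, hj'⟩ := hu' (i + u.length + u.length + 1)
    -- Two occurrences of `uu` separated by a nonempty `v` give an occurrence with `A = B = u`, `C =
    -- v`: all four images are factors of `uuvuu`. The summand `n + 1` keeps `v` nonempty.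
    obtain ⟨n, rfl⟩ : ∃ n, j = i + (u ++ u).length + (n + 1) :=
      ⟨j - (i + (u ++ u).length + 1), by rw [List.length_append]; omega⟩
    obtain ⟨v, hv, hne'⟩ : ∃ v, w.OccursAt ((u ++ u) ++ v ++ (u ++ u)) i ∧ v ≠ [] := by
      refine ⟨w.factorAt (i + (u ++ u).length) (n + 1), ?_, ?_⟩
      · rw [InfWord.occursAt_append, InfWord.occursAt_append]
        refine ⟨⟨hi, w.occursAt_factorAt _ _⟩, ?_⟩
        rwa [List.length_append (bs := w.factorAt _ _), InfWord.length_factorAt, ← Nat.add_assoc]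
      · exact fun h => by simpa [InfWord.length_factorAt] using congrArg List.length h
    refine not_isOccurrence_of_avoids hw hne hne hne' (hv.infix ⟨[], [], by simp⟩)
      (hv.infix ⟨[], [], by simp⟩) (hv.infix ⟨u, u, by simp⟩) (hv.infix ⟨[], u ++ u, by simp⟩)
  avoids ha hb hc h₁ h₂ h₃ h₄ := by
    have hsub := w.recurrentFactors_subset_factors
    exact not_isOccurrence_of_avoids hw ha hb hc (hsub h₁) (hsub h₂) (hsub h₃) (hsub h₄)

theorem sigma_involutive (c : Fin 3) : Function.Involutive (sigma c) :=
  Equiv.congr_fun (Equiv.swap_swap _ _)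

theorem recurrentFactors_map_sigma_eq {w : InfWord (Fin 3)} (c : Fin 3)
    (h : (w.map (sigma c)).recurrentFactors = b3.factors) :
    w.recurrentFactors = (b3.map (sigma c)).recurrentFactors := by
  rw [← InfWord.map_map_of_involutive (sigma_involutive c) w, InfWord.recurrentFactors_map, h,
    InfWord.recurrentFactors_map, b3_recurrentFactors]

theorem exists_recurrentFactors_eq_of_avoids {w : InfWord (Fin 3)} (hw : w.Avoids formulaB) :
    ∃ v ∈ ({b3, b3.map (sigma 0), b3.map (sigma 2)} : Set (InfWord (Fin 3))),
      w.recurrentFactors = v.recurrentFactors := by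
  have hR := formulaBFreeLanguage_of_avoids hw
  have hsq : ∀ c, ∀ u, u ++ u ∈ (w.map (sigma c)).recurrentFactors → u = [] := by
    intro c u hu
    rw [InfWord.recurrentFactors_map, Set.mem_ofPred_eq, List.map_append] at hu
    simpa using hR.eq_nil_of_square hu
  rcases hR.exists_avoided_pair with ⟨h1, h2⟩ | ⟨h1, h2⟩ | ⟨h1, h2⟩
  · refine ⟨b3, by simp, ?_⟩
    rw [recurrentFactors_eq_of_squareFree (fun u hu => hR.eq_nil_of_square hu) h1 h2,
      b3_recurrentFactors]
  · refine ⟨b3.map (sigma 0), by simp, recurrentFactors_map_sigma_eq 0 ?_⟩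
    refine recurrentFactors_eq_of_squareFree (hsq 0) ?_ ?_ <;> rw [InfWord.recurrentFactors_map]
    · exact h1
    · exact h2
  · refine ⟨b3.map (sigma 2), by simp, recurrentFactors_map_sigma_eq 2 ?_⟩
    refine recurrentFactors_eq_of_squareFree (hsq 2) ?_ ?_ <;> rw [InfWord.recurrentFactors_map]
    · exact h1
    · exact h2

/-! ### The desubstitution search for occurrences in the Thue–Morse word -/

/-- An item of a fragment: a variable, or a letter that is given as a difference of bits. -/
inductive Item where
  | var (x : TVar)
  | letter (d : SignType)

namespace Item

/-- Equality of items as a Boolean. -/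
def beq : Item → Item → Bool
  | var .A, var .A => true
  | var .B, var .B => true
  | var .C, var .C => true
  | letter .zero, letter .zero => true
  | letter .pos, letter .pos => true
  | letter .neg, letter .neg => true
  | _, _ => false

instance : BEq Item := ⟨beq⟩

instance : LawfulBEq Item where
  eq_of_beq {i j} h := by
    change beq i j = true at h
    rcases i with (_ | _ | _) | (_ | _ | _) <;> rcases j with (_ | _ | _) | (_ | _ | _) <;>
      first | rfl | cases h
  rfl {i} := by
    change beq i i = true
    rcases i with (_ | _ | _) | (_ | _ | _) <;> rfl

end Item

/-- Two bits for each variable. -/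
abbrev VarBits := (Bool × Bool) × (Bool × Bool) × (Bool × Bool)

/-- The bits of a variable. -/
def VarBits.get (b : VarBits) : TVar → Bool × Bool
  | .A => b.1
  | .B => b.2.1
  | .C => b.2.2

/-- Change the bits of a variable. -/
def VarBits.set (b : VarBits) (v : Bool × Bool) : TVar → VarBits
  | .A => (v, b.2)
  | .B => (b.1, v, b.2.2)
  | .C => (b.1, b.2.1, v)

/-- The sums of bits. -/
def VarBits.add (b q : VarBits) : VarBits :=
  ((xor b.1.1 q.1.1, xor b.1.2 q.1.2), (xor b.2.1.1 q.2.1.1, xor b.2.1.2 q.2.1.2),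
    (xor b.2.2.1 q.2.2.1, xor b.2.2.2 q.2.2.2))

/-- Fragments over variables and letters, with the first and the last bit of each variable. -/
abbrev FormulaState := List (List Item) × VarBits

namespace FormulaState

/-- The variables that appear in a state. -/
def vars (S : FormulaState) : List TVar :=
  [.A, .B, .C].filter fun x => S.1.any fun f => f.contains (.var x)

/-- The bit after the bit `v`, given the difference of the two. -/
def nextBit : SignType → Bool → Option Bool
  | .pos, false => some true
  | .neg, true => some false
  | .zero, v => some v
  | _, _ => none

/-- The difference of two consecutive bits. -/
def diffSign : Bool → Bool → SignType
  | false, true => .pos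
  | true, false => .neg
  | _, _ => .zero

/-- The bits of variables and letters in the fragment agree. -/
def fits (b : VarBits) : List Item → Bool → Bool
  | [], _ => true
  | .var x :: f, v => (b.get x).1 == v && fits b f (b.get x).2
  | .letter c :: f, v => match nextBit c v with
    | some v => fits b f v
    | none => false

/-- The fragment contains a square. -/
def hasSquare (f : List Item) : Bool :=
  f.tails.any hasSquarePrefix

/-- The preimage of a fragment under the Thue–Morse morphism, for a fragment that begins with the
bit `v` at a position of parity `p`. The list `q` contains the parities of the first and the last
position of each variable. -/
def desubstitute (b q : VarBits) : List Item → Bool → Bool → Option (List Item)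
  | [], _, _ => some []
  | .var x :: f, p, v =>
      if (b.get x).1 == v && (q.get x).1 == p then
        (desubstitute b q f (q.get x).2 (b.get x).2).map (.var x :: ·)
      else none
  | .letter .zero :: _, false, _ => none
  | .letter c :: f, false, v => (nextBit c v).bind fun v' => desubstitute b q f true v'
  | .letter c :: f, true, v =>
      (nextBit c v).bind fun v' =>
        (desubstitute b q f false v').map (.letter (diffSign (!v) v') :: ·)

/-- All pairs of bits. -/
def bitPairs : List (Bool × Bool) := [(false, false), (false, true), (true, false), (true, true)]

/-- The preimages of a fragment for all possible parities and first bits. -/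
def preimages (b q : VarBits) (f : List Item) : List (List Item) :=
  bitPairs.filterMap fun pv => desubstitute b q f pv.1 pv.2

/-- The short factors of `b₃` (the letters and the factors without the letter `1`) that are coded by
binary words with the given first and last bits. -/
def shortWords : Bool × Bool → List (List SignType)
  | (false, true) => [[.pos], [.pos, .neg, .pos]]
  | (true, false) => [[.neg], [.neg, .pos, .neg]]
  | (false, false) => [[.zero], [.pos, .neg]]
  | (true, true) => [[.zero], [.neg, .pos]]

/-- Replace a variable by a word in a fragment. -/
def substFragment (x : TVar) (c : List SignType) (f : List Item) : List Item :=
  f.flatMap fun i => if i == .var x then c.map .letter else [i]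

/-- Replace a variable by a word. -/
def subst (S : FormulaState) (x : TVar) (c : List SignType) : FormulaState :=
  (S.1.map (substFragment x c), S.2.set (false, false) x)

/-- The parities that the first and the last positions of the variables may have. -/
def parities (S : FormulaState) : List VarBits :=
  let o : TVar → List (Bool × Bool) := fun x =>
    if S.1.any fun f => f.contains (.var x) then bitPairs else [(false, false)]
  (o .A).flatMap fun u => (o .B).flatMap fun v => (o .C).map fun w => (u, v, w)

/-- The value `k b`; the kernel evaluates `b` before it passes it to `k`. -/
def forceBool {β : Type*} : Bool → (Bool → β) → β
  | false, k => k false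
  | true, k => k true

/-- See `forceBool`. -/
def forceItem {β : Type*} : Item → (Item → β) → β
  | .var .A, k => k (.var .A)
  | .var .B, k => k (.var .B)
  | .var .C, k => k (.var .C)
  | .letter .zero, k => k (.letter .zero)
  | .letter .pos, k => k (.letter .pos)
  | .letter .neg, k => k (.letter .neg)

/-- See `forceBool`. -/
def forceList {α β : Type*} (F : α → (α → β) → β) : List α → (List α → β) → β
  | [], k => k []
  | a :: l, k => F a fun a => forceList F l fun l => k (a :: l)

/-- See `forceBool`. -/
def forceState {β : Type*} (S : FormulaState) (k : FormulaState → β) : β :=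
  forceList (forceList forceItem) S.1 fun f =>
  forceBool S.2.1.1 fun a => forceBool S.2.1.2 fun a' =>
  forceBool S.2.2.1.1 fun b => forceBool S.2.2.1.2 fun b' =>
  forceBool S.2.2.2.1 fun c => forceBool S.2.2.2.2 fun c' => k (f, (a, a'), (b, b'), (c, c'))

/-- Search for an occurrence of a state in the Thue–Morse word. The value `true` means that there is
no occurrence, given that there is no shorter occurrence of a state in `anc` and, if `sq` holds,
that `b₃` is square-free. -/
def check (sq : Bool) : ℕ → List FormulaState → FormulaState → Bool
  | 0, _, _ => false
  | n + 1, anc, S => forceState S fun S =>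
      !(S.1.all fun f => fits S.2 f false || fits S.2 f true) || anc.contains S ||
        (sq && S.1.any hasSquare) ||
        ((S.vars.all fun x => (shortWords (S.2.get x)).all fun c =>
            check sq n (S :: anc) (S.subst x c)) &&
          S.parities.all fun q => ((S.1.map (preimages S.2 q)).sections).all fun F =>
            check sq n (if S.vars.isEmpty then anc else S :: anc) (F, S.2.add q))

/-- The states for a formula, where the variables at which `o` is `none` are replaced by the letter
`1`, and the other variables have the given first and last bits. -/
def initial (f : Formula TVar) (o : TVar → Option (Bool × Bool)) : FormulaState :=
  (f.reverse.map fun p => p.map fun x => if (o x).isNone then .letter .zero else .var x,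
    ((o .A).getD (false, false), (o .B).getD (false, false), (o .C).getD (false, false)))

/-- No initial state of a formula has an occurrence. -/
def checkFormula (sq : Bool) (f : Formula TVar) : Bool :=
  let l := none :: bitPairs.map some
  l.all fun u => l.all fun v => l.all fun w => check sq 20 [] (initial f fun
    | .A => u
    | .B => v
    | .C => w)

/-- Run with `sq = false`, since this search is what proves `b3` square-free; the later searches
rely on it. -/
theorem checkFormula_square : checkFormula false [[.A, .A]] = true := by
  decide +kernel

theorem checkFormula_formula1 : checkFormula true formula1 = true := by
  decide +kernel

theorem checkFormula_formula2 : checkFormula true formula2 = true := by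
  decide +kernel

theorem checkFormula_formula3 : checkFormula true formula3 = true := by
  decide +kernel

theorem checkFormula_formula4 : checkFormula true formula4 = true := by
  decide +kernel

end FormulaState

/-! ### Parity and halving of positions in the Thue–Morse word -/

theorem thueMorse_eq_xor_bodd (n : ℕ) : thueMorse n = xor (thueMorse n.div2) n.bodd := by
  conv_lhs => rw [← Nat.bit_bodd_div2 n, thueMorse_bit]
  exact Bool.xor_comm _ _

theorem thueMorse_div2 (n : ℕ) : thueMorse n.div2 = xor (thueMorse n) n.bodd := by
  rw [thueMorse_eq_xor_bodd n]
  simp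

/-- The bits at positions `2m` and `2m + 1` form the image of one bit, so they differ. -/
theorem bodd_eq_true_of_thueMorse_eq {n : ℕ} (h : thueMorse n = thueMorse (n + 1)) :
    n.bodd = true := by
  by_contra hn
  rw [Bool.not_eq_true] at hn
  rw [thueMorse_eq_xor_bodd n, thueMorse_eq_xor_bodd (n + 1), Nat.bodd_succ, Nat.div2_succ, hn] at h
  simp at h

theorem div2_add_eq {n p : ℕ} (l : ℕ) (hp : p = n.bodd.toNat) :
    (n + l).div2 = n.div2 + (p + l) / 2 := by
  have h1 := Nat.bodd_add_div2 n
  simp only [Nat.div2_val] at h1 ⊢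
  rw [hp]
  omega

theorem thueMorse_div2_add_eq {n m l i : ℕ} (hp : n.bodd = m.bodd)
    (h : ∀ j ≤ l, thueMorse (n + j) = thueMorse (m + j)) (hi : i ≤ (n.bodd.toNat + l) / 2) :
    thueMorse (n.div2 + i) = thueMorse (m.div2 + i) := by
  have h1 := Nat.bodd_add_div2 n
  have h2 := Nat.bodd_add_div2 m
  rcases Nat.eq_zero_or_pos i with rfl | hi0
  · rw [Nat.add_zero, Nat.add_zero, thueMorse_div2, thueMorse_div2, hp]
    exact congrArg (xor · m.bodd) (h 0 (Nat.zero_le _))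
  · have hb : n.bodd.toNat ≤ 1 := Bool.toNat_le _
    have := h (2 * i - n.bodd.toNat) (by omega)
    rw [show n + (2 * i - n.bodd.toNat) = 2 * (n.div2 + i) by omega,
      show m + (2 * i - n.bodd.toNat) = 2 * (m.div2 + i) by rw [hp] at hb ⊢; omega,
      thueMorse_two_mul, thueMorse_two_mul] at this
    exact this

theorem not_thueMorse_eq_eq (n : ℕ) :
    ¬ (thueMorse n = thueMorse (n + 1) ∧ thueMorse (n + 1) = thueMorse (n + 2)) := by
  rintro ⟨h1, h2⟩
  have h3 := bodd_eq_true_of_thueMorse_eq h1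
  have h4 := bodd_eq_true_of_thueMorse_eq h2
  rw [Nat.bodd_succ, h3] at h4
  simp at h4

/-- Five consecutive bits of the Thue–Morse word do not alternate. -/
theorem exists_thueMorse_eq_succ (n : ℕ) :
    ∃ i < 4, thueMorse (n + i) = thueMorse (n + (i + 1)) := by
  by_contra! h
  have trans : ∀ {x y z : Bool}, x ≠ y → y ≠ z → x = z := by decide
  have e1 : thueMorse n = thueMorse (n + 2) := trans (h 0 (by decide)) (h 1 (by decide))
  have e2 : thueMorse (n + 2) = thueMorse (n + 4) := trans (h 2 (by decide)) (h 3 (by decide))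
  obtain ⟨m, rfl | rfl⟩ := Nat.even_or_odd' n
  · refine not_thueMorse_eq_eq m ⟨?_, ?_⟩
    · rwa [show 2 * m + 2 = 2 * (m + 1) by ring, thueMorse_two_mul, thueMorse_two_mul] at e1
    · rwa [show 2 * m + 2 = 2 * (m + 1) by ring, show 2 * m + 4 = 2 * (m + 2) by ring,
        thueMorse_two_mul, thueMorse_two_mul] at e2
  · refine not_thueMorse_eq_eq m ⟨?_, ?_⟩
    · rw [show 2 * m + 1 + 2 = 2 * (m + 1) + 1 by ring, thueMorse_two_mul_add_one,
        thueMorse_two_mul_add_one] at e1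
      exact Bool.not_inj e1
    · rw [show 2 * m + 1 + 2 = 2 * (m + 1) + 1 by ring,
        show 2 * m + 1 + 4 = 2 * (m + 2) + 1 by ring, thueMorse_two_mul_add_one,
        thueMorse_two_mul_add_one] at e2
      exact Bool.not_inj e2

/-! ### Soundness of the search -/

namespace FormulaState

/-- The bits of the Thue–Morse word from position `n` to position `n + l` are given by `τ`. -/
def BitsAt (l : ℕ) (τ : ℕ → Bool) (n : ℕ) : Prop :=
  ∀ i ≤ l, thueMorse (n + i) = τ i

/-- The fragment appears in the Thue–Morse word at position `n`, for variables of lengths `ℓ` that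
are replaced by the binary words `τ`. -/
def FragmentAt (ℓ : TVar → ℕ) (τ : TVar → ℕ → Bool) : List Item → ℕ → Prop
  | [], _ => True
  | .var x :: f, n => BitsAt (ℓ x) (τ x) n ∧ FragmentAt ℓ τ f (n + ℓ x)
  | .letter d :: f, n => diffSign (thueMorse n) (thueMorse (n + 1)) = d ∧ FragmentAt ℓ τ f (n + 1)

/-- The length of the image of a fragment. -/
def fragmentLength (ℓ : TVar → ℕ) : List Item → ℕ
  | [] => 0
  | .var x :: f => ℓ x + fragmentLength ℓ f
  | .letter _ :: f => 1 + fragmentLength ℓ f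

/-- All fragments of the state appear in the Thue–Morse word, for nonempty values of the variables
with the given first and last bits. -/
def Realizes (ℓ : TVar → ℕ) (τ : TVar → ℕ → Bool) (S : FormulaState) : Prop :=
  (∀ x ∈ S.vars, 0 < ℓ x ∧ S.2.get x = (τ x 0, τ x (ℓ x))) ∧ ∀ f ∈ S.1, ∃ n, FragmentAt ℓ τ f n

variable {ℓ ℓ' : TVar → ℕ} {τ τ' : TVar → ℕ → Bool} {S S' : FormulaState} {b q : VarBits}

theorem mem_vars {x : TVar} : x ∈ S.vars ↔ ∃ f ∈ S.1, Item.var x ∈ f := by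
  rw [vars, List.mem_filter, List.any_eq_true]
  simp only [List.contains_iff_mem]
  exact and_iff_right (by cases x <;> simp)

open Classical in
/-- The total length of the variables that appear. -/
noncomputable def size (ℓ : TVar → ℕ) (S : FormulaState) : ℕ :=
  ([.A, .B, .C].map fun x => if x ∈ S.vars then ℓ x else 0).sum

theorem size_le (h : ∀ x ∈ S'.vars, x ∈ S.vars ∧ ℓ' x ≤ ℓ x) : size ℓ' S' ≤ size ℓ S := by
  refine List.sum_le_sum fun x _ => ?_
  split_ifs with h1 h2 h2
  · exact (h x h1).2
  · exact absurd (h x h1).1 h2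
  · exact Nat.zero_le _
  · exact le_rfl

theorem size_lt (h : ∀ x ∈ S'.vars, x ∈ S.vars ∧ ℓ' x ≤ ℓ x) {x : TVar} (hx : x ∈ S.vars)
    (hlt : x ∈ S'.vars → ℓ' x < ℓ x) (hpos : 0 < ℓ x) : size ℓ' S' < size ℓ S := by
  refine List.sum_lt_sum _ _ (fun x _ => ?_) ⟨x, by cases x <;> simp, ?_⟩
  · split_ifs with h1 h2 h2
    · exact (h x h1).2
    · exact absurd (h x h1).1 h2
    · exact Nat.zero_le _
    · exact le_rfl
  · rw [if_pos hx]
    split_ifs with h1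
    · exact hlt h1
    · exact hpos

theorem nextBit_diffSign (u v : Bool) : nextBit (diffSign u v) u = some v := by
  cases u <;> cases v <;> rfl

theorem fits_of_fragmentAt : ∀ {f : List Item} {n : ℕ},
    (∀ x, Item.var x ∈ f → b.get x = (τ x 0, τ x (ℓ x))) → FragmentAt ℓ τ f n →
      fits b f (thueMorse n) = true
  | [], _, _, _ => rfl
  | .var x :: f, n, hb, h => by
    have h1 := hb x (by simp)
    have h2 := h.1 0 (Nat.zero_le _)
    have h3 := h.1 (ℓ x) le_rfl
    have h4 := fits_of_fragmentAt (fun y hy => hb y (List.mem_cons_of_mem _ hy)) h.2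
    rw [h3] at h4
    rw [fits, h1, h4, ← h2]
    simp
  | .letter d :: f, n, hb, h => by
    have h4 := fits_of_fragmentAt (fun y hy => hb y (List.mem_cons_of_mem _ hy)) h.2
    rw [fits, ← h.1, nextBit_diffSign]
    exact h4

theorem fragmentAt_append : ∀ {f g : List Item} {n : ℕ}, FragmentAt ℓ τ (f ++ g) n ↔
    FragmentAt ℓ τ f n ∧ FragmentAt ℓ τ g (n + fragmentLength ℓ f)
  | [], g, n => by simp [FragmentAt, fragmentLength]
  | .var x :: f, g, n => by
    rw [List.cons_append, FragmentAt, FragmentAt, fragmentAt_append, fragmentLength, and_assoc,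
      Nat.add_assoc]
  | .letter d :: f, g, n => by
    rw [List.cons_append, FragmentAt, FragmentAt, fragmentAt_append, fragmentLength, and_assoc,
      Nat.add_assoc]

/-- The difference of the bits at positions `n` and `n + 1` of the Thue–Morse word. -/
def diffAt (n : ℕ) : SignType := diffSign (thueMorse n) (thueMorse (n + 1))

theorem diffAt_eq_of_fragmentAt : ∀ {f : List Item} {n m : ℕ}, FragmentAt ℓ τ f n →
    FragmentAt ℓ τ f m → ∀ k < fragmentLength ℓ f, diffAt (n + k) = diffAt (m + k)
  | [], n, m, _, _, k, hk => by simp [fragmentLength] at hk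
  | .var x :: f, n, m, hn, hm, k, hk => by
    rw [fragmentLength] at hk
    rcases lt_or_ge k (ℓ x) with h | h
    · rw [diffAt, diffAt, hn.1 k h.le, hm.1 k h.le, Nat.add_assoc, Nat.add_assoc,
        hn.1 (k + 1) h, hm.1 (k + 1) h]
    · have := diffAt_eq_of_fragmentAt hn.2 hm.2 (k - ℓ x) (by omega)
      rwa [show n + ℓ x + (k - ℓ x) = n + k by omega,
        show m + ℓ x + (k - ℓ x) = m + k by omega] at this
  | .letter d :: f, n, m, hn, hm, k, hk => by
    rw [fragmentLength] at hk
    rcases Nat.eq_zero_or_pos k with rfl | h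
    · exact hn.1.trans hm.1.symm
    · have := diffAt_eq_of_fragmentAt hn.2 hm.2 (k - 1) (by omega)
      rwa [show n + 1 + (k - 1) = n + k by omega, show m + 1 + (k - 1) = m + k by omega] at this

theorem fragmentLength_pos {f : List Item} (hf : f ≠ []) (h : ∀ x, Item.var x ∈ f → 0 < ℓ x) :
    0 < fragmentLength ℓ f := by
  match f with
  | .var x :: f =>
    have := h x (by simp)
    rw [fragmentLength]
    omega
  | .letter d :: f =>
    rw [fragmentLength]
    omega

theorem exists_square_of_hasSquare {f : List Item} (hf : hasSquare f = true) {n : ℕ}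
    (h : FragmentAt ℓ τ f n) (hpos : ∀ x, Item.var x ∈ f → 0 < ℓ x) :
    ∃ m p, 0 < p ∧ ∀ k < p, diffAt (m + k) = diffAt (m + p + k) := by
  obtain ⟨g, hg, hsq⟩ := List.any_eq_true.1 hf
  obtain ⟨s, rfl⟩ := List.mem_tails _ _ |>.1 hg
  obtain ⟨u, hu, v, rfl⟩ := exists_square_of_hasSquarePrefix hsq
  have h1 := fragmentAt_append.1 (fragmentAt_append.1 (fragmentAt_append.1 h).2).1
  exact ⟨_, _, fragmentLength_pos hu fun x hx => hpos x (by simp [hx]),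
    diffAt_eq_of_fragmentAt h1.1 h1.2⟩

theorem fragmentLength_map_letter (c : List SignType) :
    fragmentLength ℓ (c.map .letter) = c.length := by
  induction c with
  | nil => rfl
  | cons d c ih => rw [List.map_cons, fragmentLength, ih, List.length_cons, Nat.add_comm]

theorem fragmentAt_substFragment {x : TVar} {c : List SignType} (hc : c.length = ℓ x)
    (hx : ∀ n, BitsAt (ℓ x) (τ x) n → FragmentAt ℓ τ (c.map .letter) n) :
    ∀ {f : List Item} {n : ℕ}, FragmentAt ℓ τ f n → FragmentAt ℓ τ (substFragment x c f) n
  | [], _, _ => trivial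
  | .var y :: f, n, h => by
    rw [substFragment, List.flatMap_cons, fragmentAt_append]
    by_cases hy : y = x
    · subst hy
      rw [if_pos (beq_self_eq_true _), fragmentLength_map_letter, hc]
      exact ⟨hx n h.1, fragmentAt_substFragment hc hx h.2⟩
    · rw [if_neg (by simpa using hy)]
      exact ⟨⟨h.1, trivial⟩, fragmentAt_substFragment hc hx h.2⟩
  | .letter d :: f, n, h => by
    rw [substFragment, List.flatMap_cons, fragmentAt_append, if_neg (by simp)]
    exact ⟨⟨h.1, trivial⟩, fragmentAt_substFragment hc hx h.2⟩

theorem var_mem_substFragment {x y : TVar} {c : List SignType} {f : List Item}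
    (h : Item.var y ∈ substFragment x c f) : y ≠ x ∧ Item.var y ∈ f := by
  obtain ⟨i, hi, h⟩ := List.mem_flatMap.1 h
  split_ifs at h with hix
  · simp at h
  · rw [List.mem_singleton] at h
    subst h
    exact ⟨fun hyx => hix (by simp [hyx]), hi⟩

theorem mem_vars_subst {x y : TVar} {c : List SignType} (h : y ∈ (S.subst x c).vars) :
    y ≠ x ∧ y ∈ S.vars := by
  obtain ⟨f, hf, hy⟩ := mem_vars.1 h
  obtain ⟨g, hg, rfl⟩ := List.mem_map.1 hf
  exact ⟨(var_mem_substFragment hy).1, mem_vars.2 ⟨g, hg, (var_mem_substFragment hy).2⟩⟩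

theorem _root_.VarBits.get_set_of_ne {x y : TVar} (h : y ≠ x) (v : Bool × Bool) :
    (b.set v x).get y = b.get y := by
  cases x <;> cases y <;> first | rfl | exact absurd rfl h

theorem Realizes.subst {x : TVar} {c : List SignType} (h : Realizes ℓ τ S) (hc : c.length = ℓ x)
    (hx : ∀ n, BitsAt (ℓ x) (τ x) n → FragmentAt ℓ τ (c.map .letter) n) :
    Realizes ℓ τ (S.subst x c) := by
  refine ⟨fun y hy => ?_, fun f hf => ?_⟩
  · obtain ⟨h1, h2⟩ := mem_vars_subst hy
    exact ⟨(h.1 y h2).1, (VarBits.get_set_of_ne h1 _).trans (h.1 y h2).2⟩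
  · obtain ⟨g, hg, rfl⟩ := List.mem_map.1 hf
    obtain ⟨n, hn⟩ := h.2 g hg
    exact ⟨n, fragmentAt_substFragment hc hx hn⟩

theorem exists_bitsAt {x : TVar} : ∀ {f : List Item} {n : ℕ}, Item.var x ∈ f →
    FragmentAt ℓ τ f n → ∃ m, BitsAt (ℓ x) (τ x) m
  | .var y :: f, n, hx, h => by
    rcases List.mem_cons.1 hx with hx | hx
    · obtain rfl : x = y := by simpa using hx
      exact ⟨n, h.1⟩
    · exact exists_bitsAt hx h.2
  | .letter d :: f, n, hx, h => by
    rcases List.mem_cons.1 hx with hx | hx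
    · simp at hx
    · exact exists_bitsAt hx h.2

theorem Realizes.exists_bitsAt {x : TVar} (h : Realizes ℓ τ S) (hx : x ∈ S.vars) :
    ∃ n, BitsAt (ℓ x) (τ x) n := by
  obtain ⟨f, hf, hxf⟩ := mem_vars.1 hx
  obtain ⟨n, hn⟩ := h.2 f hf
  exact FormulaState.exists_bitsAt hxf hn

/-- A word that appears in the Thue–Morse word is short, or contains two equal consecutive bits and
has at least three bits. -/
theorem mem_shortWords_or {l : ℕ} {w : ℕ → Bool} (hl : 0 < l) {m : ℕ} (hm : BitsAt l w m) :
    (∃ c ∈ shortWords (w 0, w l), c.length = l ∧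
      ∀ n, BitsAt l w n → FragmentAt ℓ τ (c.map .letter) n) ∨
    2 ≤ l ∧ ∃ i < l, w i = w (i + 1) := by
  refine or_iff_not_imp_right.2 fun hn => ?_
  match l, hl with
  | 1, _ =>
    refine ⟨[diffSign (w 0) (w 1)], ?_, rfl, fun n hn => ⟨?_, trivial⟩⟩
    · cases w 0 <;> cases w 1 <;> simp [shortWords, diffSign]
    · rw [hn 1 le_rfl, show thueMorse n = _ from hn 0 (by decide)]
  | 2, _ =>
    have h0 : w 0 ≠ w 1 := fun h => hn ⟨le_rfl, 0, by decide, h⟩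
    have h1 : w 1 ≠ w 2 := fun h => hn ⟨le_rfl, 1, by decide, h⟩
    refine ⟨[diffSign (w 0) (w 1), diffSign (w 1) (w 2)], ?_, rfl, fun n hn => ⟨?_, ?_, trivial⟩⟩
    · revert h0 h1
      cases w 0 <;> cases w 1 <;> cases w 2 <;> simp [shortWords, diffSign]
    · rw [hn 1 (by decide), show thueMorse n = _ from hn 0 (by decide)]
    · rw [hn 1 (by decide), show thueMorse (n + 1 + 1) = _ from hn 2 le_rfl]
  | 3, _ =>
    have h0 : w 0 ≠ w 1 := fun h => hn ⟨by decide, 0, by decide, h⟩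
    have h1 : w 1 ≠ w 2 := fun h => hn ⟨by decide, 1, by decide, h⟩
    have h2 : w 2 ≠ w 3 := fun h => hn ⟨by decide, 2, by decide, h⟩
    refine ⟨[diffSign (w 0) (w 1), diffSign (w 1) (w 2), diffSign (w 2) (w 3)], ?_, rfl,
      fun n hn => ⟨?_, ?_, ?_, trivial⟩⟩
    · revert h0 h1 h2
      cases w 0 <;> cases w 1 <;> cases w 2 <;> cases w 3 <;> simp [shortWords, diffSign]
    · rw [hn 1 (by decide), show thueMorse n = _ from hn 0 (by decide)]
    · rw [hn 1 (by decide), show thueMorse (n + 1 + 1) = _ from hn 2 (by decide)]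
    · rw [show thueMorse (n + 1 + 1) = _ from hn 2 (by decide),
        show thueMorse (n + 1 + 1 + 1) = _ from hn 3 le_rfl]
  | l + 4, _ =>
    obtain ⟨i, hi, h⟩ := exists_thueMorse_eq_succ m
    rw [hm i (by omega), hm (i + 1) (by omega)] at h
    exact absurd ⟨by omega, i, by omega, h⟩ hn

/-- The length of a desubstituted variable. -/
def desubstLength (ℓ : TVar → ℕ) (q : VarBits) (x : TVar) : ℕ :=
  ((q.get x).1.toNat + ℓ x) / 2

/-- Consecutive items share a boundary bit, so an item from position `n` to `m` has a preimage from
`n.div2` to `m.div2`, and boundaries still match. A letter starting at an even position lies inside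
a block and disappears; one starting at an odd position joins two blocks and remains a letter. -/
theorem desubstitute_of_fragmentAt : ∀ {f : List Item} {n : ℕ},
    (∀ x, Item.var x ∈ f → b.get x = (τ x 0, τ x (ℓ x)) ∧ ∀ m, BitsAt (ℓ x) (τ x) m →
      q.get x = (m.bodd, (m + ℓ x).bodd) ∧ BitsAt (desubstLength ℓ q x) (τ' x) m.div2) →
    FragmentAt ℓ τ f n → ∃ f', desubstitute b q f n.bodd (thueMorse n) = some f' ∧
      FragmentAt (desubstLength ℓ q) τ' f' n.div2 ∧ ∀ x, Item.var x ∈ f' → Item.var x ∈ f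
  | [], n, _, _ => ⟨[], rfl, trivial, fun _ h => h⟩
  | .var x :: f, n, hx, h => by
    obtain ⟨h1, h2⟩ := hx x (by simp)
    obtain ⟨h3, h4⟩ := h2 n h.1
    obtain ⟨f', hf', hn, hv⟩ :=
      desubstitute_of_fragmentAt (fun y hy => hx y (List.mem_cons_of_mem _ hy)) h.2
    have e0 : thueMorse n = τ x 0 := h.1 0 (Nat.zero_le _)
    refine ⟨.var x :: f', ?_, ⟨h4, ?_⟩, ?_⟩
    · rw [h.1 (ℓ x) le_rfl] at hf'
      rw [desubstitute, if_pos (by simp [h1, h3, e0]), h1, h3, hf']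
      rfl
    · rwa [desubstLength, h3, ← div2_add_eq _ rfl]
    · intro y hy
      rcases List.mem_cons.1 hy with hy | hy
      · simp [hy]
      · exact List.mem_cons_of_mem _ (hv y hy)
  | .letter d :: f, n, hx, h => by
    obtain ⟨f', hf', hn, hv⟩ :=
      desubstitute_of_fragmentAt (fun y hy => hx y (List.mem_cons_of_mem _ hy)) h.2
    have hbit : nextBit d (thueMorse n) = some (thueMorse (n + 1)) := by
      rw [← h.1, nextBit_diffSign]
    rw [Nat.bodd_succ] at hf'
    cases hp : n.bodd
    · refine ⟨f', ?_, ?_, fun y hy => List.mem_cons_of_mem _ (hv y hy)⟩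
      · rw [hp] at hf'
        cases d
        · exfalso
          have h2 : thueMorse n = thueMorse (n + 1) := by
            have := h.1
            revert this
            cases thueMorse n <;> cases thueMorse (n + 1) <;> simp [diffSign]
          simp [bodd_eq_true_of_thueMorse_eq h2] at hp
        all_goals
          rw [desubstitute, hbit]
          · exact hf'
          · nofun
      · rwa [Nat.div2_succ, hp] at hn
    · refine ⟨.letter (diffSign (!thueMorse n) (thueMorse (n + 1))) :: f', ?_, ⟨?_, ?_⟩, ?_⟩
      · rw [hp] at hf'
        cases d
        all_goals
          rw [desubstitute, hbit, Option.bind_some]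
          exact congrArg (Option.map _) hf'
      · rw [thueMorse_div2, hp, Bool.xor_true]
        have := thueMorse_div2 (n + 1)
        rw [Nat.div2_succ, Nat.bodd_succ, hp] at this
        simpa using congrArg (diffSign (!thueMorse n)) this
      · rw [Nat.div2_succ, hp] at hn
        exact hn
      · intro y hy
        rcases List.mem_cons.1 hy with hy | hy
        · simp at hy
        · exact List.mem_cons_of_mem _ (hv y hy)

/-- Each variable that appears has at least three bits, two consecutive ones of which are equal. -/
def IsLong (ℓ : TVar → ℕ) (τ : TVar → ℕ → Bool) (S : FormulaState) : Prop :=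
  ∀ x ∈ S.vars, 2 ≤ ℓ x ∧ ∃ i < ℓ x, τ x i = τ x (i + 1)

/-- An equal pair of bits starts at an odd position, which fixes the parity of each occurrence. -/
theorem bodd_eq_of_bitsAt {l i n m : ℕ} {w : ℕ → Bool} (hi : i < l) (hw : w i = w (i + 1))
    (hn : BitsAt l w n) (hm : BitsAt l w m) : n.bodd = m.bodd := by
  have key : ∀ {n}, BitsAt l w n → n.bodd = !i.bodd := by
    intro n hn
    rw [← hn i hi.le, ← hn (i + 1) hi] at hw
    have := bodd_eq_true_of_thueMorse_eq hw
    rw [Nat.bodd_add] at this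
    revert this
    cases n.bodd <;> cases i.bodd <;> simp
  rw [key hn, key hm]

theorem _root_.VarBits.get_add (b q : VarBits) (x : TVar) : (b.add q).get x =
    (xor (b.get x).1 (q.get x).1, xor (b.get x).2 (q.get x).2) := by
  cases x <;> rfl

/-- For long variables the parities do not depend on the occurrence, so one choice of `q` and one
preimage per variable serve all fragments. Halving strictly shortens a variable of length at least 2
and keeps it nonempty. -/
theorem Realizes.desubstitute (h : Realizes ℓ τ S) (hlong : IsLong ℓ τ S) :
    ∃ q ∈ S.parities, ∃ F ∈ (S.1.map (preimages S.2 q)).sections, ∃ ℓ' τ',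
      Realizes ℓ' τ' (F, S.2.add q) ∧
      ∀ x ∈ vars (F, S.2.add q), x ∈ S.vars ∧ ℓ' x < ℓ x := by
  classical
  have hpos : ∀ x, ∃ n, x ∈ S.vars → BitsAt (ℓ x) (τ x) n := by
    intro x
    by_cases hx : x ∈ S.vars
    · obtain ⟨n, hn⟩ := h.exists_bitsAt hx
      exact ⟨n, fun _ => hn⟩
    · exact ⟨0, fun h => absurd h hx⟩
  choose N hN using hpos
  let o : TVar → Bool × Bool := fun x =>
    if x ∈ S.vars then ((N x).bodd, (N x + ℓ x).bodd) else (false, false)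
  let q : VarBits := (o .A, o .B, o .C)
  have hq : ∀ x, q.get x = o x := by rintro (_ | _ | _) <;> rfl
  have hq' : ∀ x ∈ S.vars, ∀ m, BitsAt (ℓ x) (τ x) m → q.get x = (m.bodd, (m + ℓ x).bodd) ∧
      BitsAt (desubstLength ℓ q x) (fun i => thueMorse ((N x).div2 + i)) m.div2 := by
    intro x hx m hm
    obtain ⟨i, hi, hw⟩ := (hlong x hx).2
    have h1 : (N x).bodd = m.bodd := bodd_eq_of_bitsAt hi hw (hN x hx) hm
    have h2 : q.get x = (m.bodd, (m + ℓ x).bodd) := by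
      rw [hq]
      simp only [o, if_pos hx, Nat.bodd_add, h1]
    refine ⟨h2, fun i hi => ?_⟩
    rw [desubstLength, h2] at hi
    exact thueMorse_div2_add_eq h1.symm (fun j hj => by rw [hm j hj, hN x hx j hj]) hi
  have hqmem : q ∈ S.parities := by
    have key : ∀ x, o x ∈ if S.1.any fun f => f.contains (.var x) then bitPairs
        else [(false, false)] := by
      intro x
      have hx : x ∈ S.vars ↔ (S.1.any fun f => f.contains (.var x)) = true := by
        rw [mem_vars, List.any_eq_true]
        simp only [List.contains_iff_mem]
      by_cases hxS : x ∈ S.vars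
      · rw [if_pos (hx.1 hxS)]
        generalize o x = v
        revert v
        decide
      · rw [if_neg (fun h => hxS (hx.2 h))]
        simp [o, hxS]
    simp only [parities, List.mem_flatMap, List.mem_map]
    exact ⟨_, key .A, _, key .B, _, key .C, rfl⟩
  have hF : ∀ f ∈ S.1, ∃ f', f' ∈ preimages S.2 q f ∧ (∃ n,
      FragmentAt (desubstLength ℓ q) (fun x i => thueMorse ((N x).div2 + i)) f' n) ∧
      ∀ x, Item.var x ∈ f' → Item.var x ∈ f := by
    intro f hf
    obtain ⟨n, hn⟩ := h.2 f hf
    have hx : ∀ x, Item.var x ∈ f → x ∈ S.vars := fun x hx => mem_vars.2 ⟨f, hf, hx⟩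
    obtain ⟨f', h1, h2, h3⟩ := desubstitute_of_fragmentAt (b := S.2) (q := q)
      (τ' := fun x i => thueMorse ((N x).div2 + i))
      (fun x hxf => ⟨(h.1 x (hx x hxf)).2, hq' x (hx x hxf)⟩) hn
    refine ⟨f', List.mem_filterMap.2 ⟨(n.bodd, thueMorse n), ?_, h1⟩, ⟨_, h2⟩, h3⟩
    generalize (n.bodd, thueMorse n) = v
    revert v
    decide
  choose! g hg1 hg2 hg3 using hF
  refine ⟨q, hqmem, S.1.map g, ?_, desubstLength ℓ q, fun x i => thueMorse ((N x).div2 + i), ?_⟩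
  · rw [List.mem_sections, List.forall₂_map_left_iff, List.forall₂_map_right_iff,
      List.forall₂_same]
    exact hg1
  · have hvars : ∀ x ∈ vars (S.1.map g, S.2.add q), x ∈ S.vars := by
      intro x hx
      obtain ⟨f', hf', hxf⟩ := mem_vars.1 hx
      obtain ⟨f, hf, rfl⟩ := List.mem_map.1 hf'
      exact mem_vars.2 ⟨f, hf, hg3 f hf x hxf⟩
    have hlen : ∀ x ∈ S.vars, 0 < desubstLength ℓ q x ∧ desubstLength ℓ q x < ℓ x := by
      intro x hx
      have h1 := (hlong x hx).1
      have h2 : (q.get x).1.toNat ≤ 1 := Bool.toNat_le _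
      rw [desubstLength]
      omega
    refine ⟨⟨fun x hx => ⟨(hlen x (hvars x hx)).1, ?_⟩, fun f' hf' => ?_⟩,
      fun x hx => ⟨hvars x hx, (hlen x (hvars x hx)).2⟩⟩
    · have hx := hvars x hx
      have h1 := (hq' x hx (N x) (hN x hx)).1
      have h2 : τ x 0 = thueMorse (N x) := (hN x hx 0 (Nat.zero_le _)).symm
      have h3 := hN x hx (ℓ x) le_rfl
      rw [VarBits.get_add, (h.1 x hx).2, h1, h2, ← h3]
      refine Prod.ext ?_ ?_
      · exact (thueMorse_div2 _).symm
      · have h4 : (N x + ℓ x).div2 = (N x).div2 + desubstLength ℓ q x := by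
          rw [desubstLength, h1]
          exact div2_add_eq _ rfl
        change _ = thueMorse ((N x).div2 + desubstLength ℓ q x)
        rw [← h4]
        exact (thueMorse_div2 _).symm
    · obtain ⟨f, hf, rfl⟩ := List.mem_map.1 hf'
      exact hg2 f hf

theorem forceBool_eq {β : Type*} (a : Bool) (k : Bool → β) : forceBool a k = k a := by
  cases a <;> rfl

theorem forceItem_eq {β : Type*} (a : Item) (k : Item → β) : forceItem a k = k a := by
  rcases a with (_ | _ | _) | (_ | _ | _) <;> rfl

theorem forceList_eq {α β : Type*} {F : α → (α → β) → β} (hF : ∀ a k, F a k = k a) (l : List α)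
    (k : List α → β) : forceList F l k = k l := by
  induction l generalizing k with
  | nil => rfl
  | cons a l ih => rw [forceList, hF, ih]

theorem forceState_eq {β : Type*} (S : FormulaState) (k : FormulaState → β) :
    forceState S k = k S := by
  simp only [forceState, forceBool_eq]
  exact forceList_eq (forceList_eq forceItem_eq) _ _

/-- A state that passes the search is not realized if `b₃` is square-free, and if no state in `anc`
has a realization of at most the same size. -/
theorem not_realizes_of_check {sq : Bool}
    (hsq : sq = true → ¬ ∃ m p, 0 < p ∧ ∀ k < p, diffAt (m + k) = diffAt (m + p + k)) (n : ℕ)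
    {anc : List FormulaState} (hc : check sq n anc S = true) (h : Realizes ℓ τ S)
    (hanc : ∀ S' ∈ anc, ∀ ℓ' τ', Realizes ℓ' τ' S' → size ℓ S < size ℓ' S') : False := by
  induction n generalizing S anc ℓ τ with
  | zero => simp [check] at hc
  | succ n ihn =>
    -- Within a fixed fuel, induction on the size allows the realization to be assumed minimal, so
    -- that `S` itself may join the ancestors of any smaller state.
    induction hm : size ℓ S using Nat.strong_induction_on generalizing ℓ τ with
    | _ m ihm =>
    have hmin : ∀ ℓ' τ', Realizes ℓ' τ' S → size ℓ S ≤ size ℓ' S := by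
      intro ℓ' τ' h'
      by_contra! hlt
      exact ihm _ (hm ▸ hlt) h' (fun S' hS' ℓ'' τ'' h'' =>
        hlt.trans (hanc S' hS' ℓ'' τ'' h'')) rfl
    have hanc' : ∀ {S₁ : FormulaState} {ℓ₁}, size ℓ₁ S₁ < size ℓ S →
        ∀ S' ∈ S :: anc, ∀ ℓ' τ', Realizes ℓ' τ' S' → size ℓ₁ S₁ < size ℓ' S' := by
      intro S₁ ℓ₁ hlt S' hS' ℓ' τ' h'
      rcases List.mem_cons.1 hS' with rfl | hS'
      · exact hlt.trans_le (hmin ℓ' τ' h')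
      · exact hlt.trans (hanc S' hS' ℓ' τ' h')
    have hc' := hc
    rw [check, forceState_eq] at hc'
    simp only [Bool.or_eq_true, Bool.not_eq_true', Bool.and_eq_true, List.all_eq_false,
      List.all_eq_true, List.contains_iff_mem] at hc'
    have hvar : ∀ f ∈ S.1, ∀ x, Item.var x ∈ f → x ∈ S.vars :=
      fun f hf x hx => mem_vars.2 ⟨f, hf, hx⟩
    rcases hc' with ((⟨f, hf, hc'⟩ | hc') | ⟨hs, hc'⟩) | ⟨hc1, hc2⟩
    · obtain ⟨k, hk⟩ := h.2 f hf
      have := fits_of_fragmentAt (b := S.2) (fun x hx => (h.1 x (hvar f hf x hx)).2) hk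
      refine hc' ?_
      cases htm : thueMorse k <;> rw [htm] at this
      · exact Or.inl this
      · exact Or.inr this
    · exact lt_irrefl _ (hanc S hc' ℓ τ h)
    · obtain ⟨f, hf, hfs⟩ := List.any_eq_true.1 hc'
      obtain ⟨k, hk⟩ := h.2 f hf
      exact hsq hs (exists_square_of_hasSquare hfs hk fun x hx => (h.1 x (hvar f hf x hx)).1)
    · by_cases hlong : IsLong ℓ τ S
      · obtain ⟨q, hq, F, hF, ℓ', τ', h', hv⟩ := h.desubstitute hlong
        refine ihn (hc2 q hq F hF) h' ?_
        -- Without variables the size is 0 and does not drop, so `S` is not added to the ancestors.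
        split_ifs with hvars
        · intro S' hS' ℓ'' τ'' h''
          exact (size_le fun x hx => ⟨(hv x hx).1, (hv x hx).2.le⟩).trans_lt
            (hanc S' hS' ℓ'' τ'' h'')
        · obtain ⟨x, hx⟩ := List.exists_mem_of_ne_nil _ (by simpa using hvars)
          exact hanc' (size_lt (fun x hx => ⟨(hv x hx).1, (hv x hx).2.le⟩) hx
            (fun hx => (hv x hx).2) (h.1 x hx).1)
      · simp only [IsLong, not_forall] at hlong
        obtain ⟨x, hx, hxl⟩ := hlong
        obtain ⟨k, hk⟩ := h.exists_bitsAt hx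
        obtain ⟨c, hcs, hcl, hc⟩ :=
          (mem_shortWords_or (ℓ := ℓ) (τ := τ) (h.1 x hx).1 hk).resolve_right hxl
        refine ihn (hc1 x hx c (by rwa [(h.1 x hx).2])) (h.subst hcl hc) ?_
        exact hanc' (size_lt (fun y hy => ⟨(mem_vars_subst hy).2, le_rfl⟩) hx
          (fun hx => absurd rfl (mem_vars_subst hx).1) (h.1 x hx).1)

end FormulaState

/-! ### From occurrences in `b3` to realized states -/

theorem b3_eq_iff (m n : ℕ) : b3 m = b3 n ↔ FormulaState.diffAt m = FormulaState.diffAt n := by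
  have key : ∀ a b c d : Bool, diffLetter a b = diffLetter c d ↔
      FormulaState.diffSign a b = FormulaState.diffSign c d := by decide
  rw [← diffWord_thueMorse]
  exact key _ _ _ _

theorem b3_eq_one_iff (n : ℕ) : b3 n = 1 ↔ thueMorse n = thueMorse (n + 1) := by
  have key : ∀ a b : Bool, diffLetter a b = 1 ↔ a = b := by decide
  rw [← diffWord_thueMorse]
  exact key _ _

theorem exists_b3_ne_one {u : List (Fin 3)} {n : ℕ} (hn : b3.OccursAt u n) (hu : u ≠ [])
    (hu1 : u ≠ [1]) : ∃ k < u.length, b3 (n + k) ≠ 1 := by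
  match u with
  | [a] =>
    refine ⟨0, Nat.zero_lt_one, fun h => hu1 ?_⟩
    rw [← InfWord.occursAt_singleton.1 hn, ← h]
    rfl
  | a :: b :: u =>
    by_contra! h
    have h0 := (b3_eq_one_iff _).1 (h 0 (by simp))
    have h1 := (b3_eq_one_iff _).1 (h 1 (by simp))
    exact not_thueMorse_eq_eq n ⟨h0, h1⟩

/-- A factor of `b₃` other than the letter `1` determines the bits of the Thue–Morse word. -/
theorem thueMorse_eq_of_occursAt {u : List (Fin 3)} {n m : ℕ} (hn : b3.OccursAt u n)
    (hm : b3.OccursAt u m) (hu : u ≠ []) (hu1 : u ≠ [1]) :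
    ∀ i ≤ u.length, thueMorse (n + i) = thueMorse (m + i) := by
  have hl : ∀ k < u.length, diffLetter (thueMorse (n + k)) (thueMorse (n + (k + 1))) =
      diffLetter (thueMorse (m + k)) (thueMorse (m + (k + 1))) := by
    rw [← diffWord_thueMorse, InfWord.occursAt_iff] at hn hm
    exact fun k hk => (hn k hk).trans (hm k hk).symm
  have hstep : ∀ a b c d : Bool, diffLetter a b = diffLetter c d → (b = d ↔ a = c) := by decide
  have hfix : ∀ a b c d : Bool, diffLetter a b = diffLetter c d → a ≠ b → a = c := by decide
  have hiff : ∀ i ≤ u.length,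
      thueMorse (n + i) = thueMorse (m + i) ↔ thueMorse n = thueMorse m := by
    intro i
    induction i with
    | zero => exact fun _ => Iff.rfl
    | succ i ih => exact fun hi => (hstep _ _ _ _ (hl i hi)).trans (ih (by omega))
  -- A letter 0 or 2 fixes its two bits, and differences propagate agreement to all other positions.
  -- The word `1` alone codes both `00` and `11`, which is why `initial` treats it as a letter.
  obtain ⟨k, hk, hk1⟩ := exists_b3_ne_one hn hu hu1
  rw [Ne, b3_eq_one_iff] at hk1
  exact fun i hi => (hiff i hi).2 ((hiff k hk.le).1 (hfix _ _ _ _ (hl k hk) hk1))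

namespace FormulaState

theorem fragmentAt_of_occursAt {h : TVar → List (Fin 3)} {N : TVar → ℕ}
    {o : TVar → Option (Bool × Bool)} (ho : ∀ x, (o x).isNone = true ↔ h x = [1])
    (hN : ∀ x n, h x ≠ [1] → b3.OccursAt (h x) n →
      BitsAt (h x).length (fun i => thueMorse (N x + i)) n) :
    ∀ {p : List TVar} {n : ℕ}, b3.OccursAt (morphImage h p) n →
      FragmentAt (fun x => (h x).length) (fun x i => thueMorse (N x + i))
        (p.map fun x => if (o x).isNone then .letter .zero else .var x) n
  | [], _, _ => trivial
  | x :: p, n, hp => by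
    obtain ⟨h1, h2⟩ := InfWord.occursAt_append.1
      (show b3.OccursAt (h x ++ morphImage h p) n from hp)
    rw [List.map_cons]
    by_cases hx : h x = [1]
    · rw [if_pos ((ho x).2 hx)]
      rw [hx] at h1 h2
      refine ⟨?_, fragmentAt_of_occursAt ho hN h2⟩
      rw [← (b3_eq_one_iff n).1 (InfWord.occursAt_singleton.1 h1)]
      cases thueMorse n <;> rfl
    · rw [if_neg (fun h => hx ((ho x).1 h))]
      exact ⟨hN x n hx h1, fragmentAt_of_occursAt ho hN h2⟩

theorem not_isOccurrence_of_checkFormula {sq : Bool} {f : Formula TVar}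
    (hc : checkFormula sq f = true)
    (hsq : sq = true → ¬ ∃ m p, 0 < p ∧ ∀ k < p, diffAt (m + k) = diffAt (m + p + k))
    (h : TVar → List (Fin 3)) : ¬ IsOccurrence h f b3 := by
  rintro ⟨hne, hf⟩
  have hpos : ∀ x, ∃ n, h x ∈ b3.factors → b3.OccursAt (h x) n := by
    intro x
    by_cases hx : h x ∈ b3.factors
    · obtain ⟨n, hn⟩ := hx
      exact ⟨n, fun _ => hn⟩
    · exact ⟨0, fun h => absurd h hx⟩
  choose N hN using hpos
  let o : TVar → Option (Bool × Bool) := fun x =>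
    if h x = [1] then none else some (thueMorse (N x), thueMorse (N x + (h x).length))
  have ho : ∀ x, (o x).isNone = true ↔ h x = [1] := by
    intro x
    by_cases hx : h x = [1] <;> simp [o, hx]
  have hol : ∀ x, o x ∈ none :: bitPairs.map some := by
    intro x
    generalize o x = v
    revert v
    decide
  simp only [checkFormula, List.all_eq_true] at hc
  refine not_realizes_of_check hsq 20 (hc _ (hol .A) _ (hol .B) _ (hol .C))
    (ℓ := fun x => (h x).length) (τ := fun x i => thueMorse (N x + i)) ⟨?_, ?_⟩ (by simp)
  · intro x hx
    refine ⟨List.length_pos_of_ne_nil (hne x), ?_⟩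
    have hx1 : h x ≠ [1] := by
      obtain ⟨g, hg, hxg⟩ := mem_vars.1 hx
      obtain ⟨p, -, rfl⟩ := List.mem_map.1 hg
      obtain ⟨y, -, hy⟩ := List.mem_map.1 hxg
      intro hx1
      have h1 := (ho x).2 hx1
      split_ifs at hy with hy1
      obtain rfl : y = x := by simpa using hy
      cases y <;> exact hy1 h1
    cases x <;> simp [initial, VarBits.get, o, hx1]
  · intro g hg
    obtain ⟨p, hp, rfl⟩ := List.mem_map.1 hg
    obtain ⟨n, hn⟩ := hf p (List.mem_reverse.1 hp)
    refine ⟨n, fragmentAt_of_occursAt (fun x => ?_) (fun x n hx1 hn => ?_) hn⟩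
    · rw [← ho]
      cases x <;> rfl
    · exact thueMorse_eq_of_occursAt hn (hN x ⟨n, hn⟩) (hne x) hx1

theorem not_exists_square :
    ¬ ∃ m p, 0 < p ∧ ∀ k < p, diffAt (m + k) = diffAt (m + p + k) := by
  rintro ⟨m, p, hp, h⟩
  refine not_isOccurrence_of_checkFormula checkFormula_square (by simp)
    (fun _ => b3.factorAt m p) ⟨fun _ h0 => ?_, fun f hf => ⟨m, ?_⟩⟩
  · have := congrArg List.length h0
    rw [InfWord.length_factorAt, List.length_nil] at this
    omega
  · rw [List.mem_singleton] at hf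
    subst hf
    have heq : b3.factorAt m p = b3.factorAt (m + p) p :=
      congrArg List.ofFn (funext fun k => (b3_eq_iff _ _).2 (h k k.2))
    change b3.OccursAt (b3.factorAt m p ++ (b3.factorAt m p ++ [])) m
    rw [List.append_nil, InfWord.occursAt_append, InfWord.length_factorAt]
    refine ⟨b3.occursAt_factorAt m p, ?_⟩
    rw [heq]
    exact b3.occursAt_factorAt (m + p) p

end FormulaState

theorem b3_avoids_of_checkFormula {f : Formula TVar}
    (hc : FormulaState.checkFormula true f = true) : b3.Avoids f := fun ⟨h, hf⟩ =>
  FormulaState.not_isOccurrence_of_checkFormula hc (fun _ => FormulaState.not_exists_square) h hf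

/-! ### Transfer between formulas and the theorem -/

theorem InfWord.Avoids.of_infix {Δ α : Type*} {w : InfWord α} {f g : Formula Δ} (hw : w.Avoids f)
    (hfg : ∀ p ∈ f, ∃ q ∈ g, p <:+: q) : w.Avoids g := by
  rintro ⟨h, hne, hg⟩
  refine hw ⟨h, hne, fun p hp => ?_⟩
  obtain ⟨q, hq, s, t, rfl⟩ := hfg p hp
  obtain ⟨i, hi⟩ := hg _ hq
  refine hi.infix ⟨morphImage h s, morphImage h t, ?_⟩
  rw [← morphImage_append, ← morphImage_append]

theorem InfWord.Avoids.map {Δ α β : Type*} {w : InfWord α} {f : Formula Δ} (hw : w.Avoids f)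
    (e : α ≃ β) : (w.map e).Avoids f := by
  rintro ⟨h, hne, hf⟩
  refine hw ⟨fun X => (h X).map e.symm, fun X => by simpa using hne X, fun p hp => ?_⟩
  have := hf p hp
  rw [InfWord.factors_map, Set.mem_ofPred_eq] at this
  rwa [morphImage, List.map_flatMap] at this

theorem InfWord.Recurrent.map {α β : Type*} {w : InfWord α} (hw : w.Recurrent) (e : α ≃ β) :
    (w.map e).Recurrent := by
  intro u hu
  rw [InfWord.factors_map] at hu
  rw [InfWord.recurrentFactors_map]
  exact hw _ hu

theorem InfWord.Recurrent.recurrentFactors_eq {α : Type*} {w : InfWord α} (hw : w.Recurrent) :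
    w.recurrentFactors = w.factors :=
  w.recurrentFactors_subset_factors.antisymm hw

theorem b3_recurrent : b3.Recurrent := b3_recurrentFactors.ge

/-- Every fragment of `f` is a factor of a fragment of `ABCAB.ABCBA.ACB.BAC`. -/
theorem exists_infix_formulaB {f : Formula TVar}
    (hf : f ∈ ({formulaB, formula1, formula2, formula3, formula4} : Set (Formula TVar))) :
    ∀ p ∈ f, ∃ q ∈ formulaB, p <:+: q := by
  have h1 : ∀ s t : List TVar, ∀ p, s ++ p ++ t = [.A, .B, .C, .A, .B] →
      ∃ q ∈ formulaB, p <:+: q := fun s t p h => ⟨_, by simp [formulaB], s, t, h⟩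
  have h2 : ∀ s t : List TVar, ∀ p, s ++ p ++ t = [.A, .B, .C, .B, .A] →
      ∃ q ∈ formulaB, p <:+: q := fun s t p h => ⟨_, by simp [formulaB], s, t, h⟩
  have h3 : ∀ s t : List TVar, ∀ p, s ++ p ++ t = [.A, .C, .B] →
      ∃ q ∈ formulaB, p <:+: q := fun s t p h => ⟨_, by simp [formulaB], s, t, h⟩
  have h4 : ∀ s t : List TVar, ∀ p, s ++ p ++ t = [.B, .A, .C] →
      ∃ q ∈ formulaB, p <:+: q := fun s t p h => ⟨_, by simp [formulaB], s, t, h⟩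
  have bcab := h1 [.A] [] [.B, .C, .A, .B] rfl
  have abca := h1 [] [.B] [.A, .B, .C, .A] rfl
  have bcb := h2 [.A] [.A] [.B, .C, .B] rfl
  have cba := h2 [.A, .B] [] [.C, .B, .A] rfl
  have ac := h4 [.B] [] [.A, .C] rfl
  have ba := h4 [] [.C] [.B, .A] rfl
  have abcab := h1 [] [] [.A, .B, .C, .A, .B] rfl
  have acb := h3 [] [] [.A, .C, .B] rfl
  rcases hf with rfl | rfl | rfl | rfl | rfl
  · exact fun p hp => ⟨p, hp, List.infix_rfl⟩
  all_goals
    intro p hp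
    simp only [formula1, formula2, formula3, formula4, List.mem_cons, List.not_mem_nil,
      or_false] at hp
  · rcases hp with rfl | rfl | rfl | rfl <;> assumption
  · rcases hp with rfl | rfl | rfl <;> assumption
  · rcases hp with rfl | rfl | rfl | rfl <;> assumption
  · rcases hp with rfl | rfl | rfl | rfl | rfl <;> assumption

theorem b3_avoids {f : Formula TVar}
    (hf : f ∈ ({formulaB, formula1, formula2, formula3, formula4} : Set (Formula TVar))) :
    b3.Avoids f := by
  -- This settles `formulaB` as well, since the fragments of `formula2` are factors of its
  -- fragments.
  have h2 := b3_avoids_of_checkFormula FormulaState.checkFormula_formula2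
  rcases hf with rfl | rfl | rfl | rfl | rfl
  · exact h2.of_infix (exists_infix_formulaB (by simp))
  · exact b3_avoids_of_checkFormula FormulaState.checkFormula_formula1
  · exact h2
  · exact b3_avoids_of_checkFormula FormulaState.checkFormula_formula3
  · exact b3_avoids_of_checkFormula FormulaState.checkFormula_formula4

theorem theorem2 (f : Formula TVar)
    (hf : f ∈ ({formulaB, formula1, formula2, formula3, formula4} : Set (Formula TVar))) :
    (∀ w : InfWord (Fin 3), w.Recurrent → w.Avoids f →
      w.Equivalent b3 ∨ w.Equivalent (b3.map (sigma 0)) ∨ w.Equivalent (b3.map (sigma 2))) ∧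
    (∀ v ∈ ({b3, b3.map (sigma 0), b3.map (sigma 2)} : Set (InfWord (Fin 3))),
      v.Recurrent ∧ v.Avoids f) ∧
    (∀ w : InfWord (Fin 3), w.Avoids f →
      ∃ v ∈ ({b3, b3.map (sigma 0), b3.map (sigma 2)} : Set (InfWord (Fin 3))),
        w.recurrentFactors = v.recurrentFactors) := by
  have h2 : ∀ v ∈ ({b3, b3.map (sigma 0), b3.map (sigma 2)} : Set (InfWord (Fin 3))),
      v.Recurrent ∧ v.Avoids f := by
    rintro v (rfl | rfl | rfl)
    · exact ⟨b3_recurrent, b3_avoids hf⟩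
    · exact ⟨b3_recurrent.map _, (b3_avoids hf).map _⟩
    · exact ⟨b3_recurrent.map _, (b3_avoids hf).map _⟩
  have h3 : ∀ w : InfWord (Fin 3), w.Avoids f →
      ∃ v ∈ ({b3, b3.map (sigma 0), b3.map (sigma 2)} : Set (InfWord (Fin 3))),
        w.recurrentFactors = v.recurrentFactors := fun w hw =>
    exists_recurrentFactors_eq_of_avoids (hw.of_infix (exists_infix_formulaB hf))
  refine ⟨fun w hw hwf => ?_, h2, h3⟩
  obtain ⟨v, hv, h⟩ := h3 w hwf
  rw [hw.recurrentFactors_eq, (h2 v hv).1.recurrentFactors_eq] at h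
  rcases hv with rfl | rfl | rfl
  · exact Or.inl h
  · exact Or.inr (Or.inl h)
  · exact Or.inr (Or.inr h)
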